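/- Work with $\infty$-categories modelled as quasicategories. Let $p\colon \mathcal{E}\to\mathcal{B}$ be a cartesian fibration of $\infty$-categories, i.e. an inner fibration such that for every object $x$ of $\mathcal{E}$, every morphism $f\colon b\to p(x)$ of $\mathcal{B}$ is the image of a $p$-cartesian morphism $f^*x\to x$ of $\mathcal{E}$. (A morphism $e$ of $\mathcal{E}$ is $p$-cartesian if for all $m\ge 2$ every lifting problem of $\Lambda^m_m\subset\Delta^m$ against $p$ in which the last edge of the horn is sent to $e$ has a solution.) Let $\mathcal{E}_0\subseteq\mathcal{E}$ be a subcategory, i.e. a simplicial subset whose inclusion is an inner fibration. Suppose that: (i) for every object $x\in\mathcal{E}_0$ and every morphism $f\colon b\to p(x)$ in $\mathcal{B}$, there is a $p$-cartesian morphism $f^*x\to x$ over $f$ that lies in $\mathcal{E}_0$; (ii) if $x$ and $y$ are objects of $\mathcal{E}_0$, $\phi\colon x\to y$ is a morphism of $\mathcal{E}$, and $p(\phi)^*y\to y$ is a $p$-cartesian morphism over $p(\phi)$ that lies in $\mathcal{E}_0$, then $\phi$ lies in $\mathcal{E}_0$ if and only if the induced morphism $x\to p(\phi)^*y$ lies in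 $\mathcal{E}_0$. (Here an induced morphism $x\to p(\phi)^*y$ means any morphism $\psi$ over $\mathrm{id}_{p(x)}$ for which there is a 2-simplex of $\mathcal{E}$ exhibiting $\phi$ as the composite of $\psi$ with $p(\phi)^*y\to y$ and lying over the degenerate 2-simplex that exhibits $p(\phi)=p(\phi)\circ\mathrm{id}_{p(x)}$.) Then $p|_{\mathcal{E}_0}\colon\mathcal{E}_0\to\mathcal{B}$ is a cartesian fibration, and a morphism of $\mathcal{E}_0$ is $p|_{\mathcal{E}_0}$-cartesian if and only if its image in $\mathcal{E}$ is $p$-cartesian. -/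

import Mathlib

open CategoryTheory Simplicial Opposite

universe u

namespace CartFib

/-- The edge of the outer horn `Λ[n+2, n+2]` joining the vertices `n+1` and `n+2`. -/
def lastEdge (n : ℕ) : (Λ[n + 2, Fin.last (n + 2)] : SSet.{u}) _⦋1⦌ :=
  SSet.horn.edge (n + 2) (Fin.last (n + 2)) (Fin.last (n + 1)).castSucc (Fin.last (n + 2))
    (Fin.le_last _) (by
      have h : ({Fin.last (n + 2), (Fin.last (n + 1)).castSucc, Fin.last (n + 2)} :
          Finset (Fin (n + 3))) = {(Fin.last (n + 1)).castSucc, Fin.last (n + 2)} := by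
        ext x; simp only [Finset.mem_insert, Finset.mem_singleton]; tauto
      rw [h]
      exact Finset.card_le_two.trans (by omega))

/-- An edge `e` of `X` is `q`-cartesian if, for every `m ≥ 2`, every lifting problem of the horn
inclusion `Λ[m, m] ⟶ Δ[m]` against `q` whose upper map sends the last edge of the horn
to `e` has a solution. -/
def IsCartesianEdge {X S : SSet.{u}} (q : X ⟶ S) (e : X _⦋1⦌) : Prop :=
  ∀ (n : ℕ) (σ₀ : (Λ[n + 2, Fin.last (n + 2)] : SSet.{u}) ⟶ X) (τ : Δ[n + 2] ⟶ S),
    σ₀ ≫ q = Λ[n + 2, Fin.last (n + 2)].ι ≫ τ →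
    σ₀.app _ (lastEdge n) = e →
    ∃ σ : Δ[n + 2] ⟶ X, Λ[n + 2, Fin.last (n + 2)].ι ≫ σ = σ₀ ∧ σ ≫ q = τ

/-- A cartesian fibration: an inner fibration `q : X ⟶ S` such that every edge
`f : s ⟶ q(y)` of `S` is the image of a `q`-cartesian edge of `X` with target `y`.
(`δ 0` is the target of an edge, `δ 1` its source.) -/
structure IsCartesianFibration {X S : SSet.{u}} (q : X ⟶ S) : Prop where
  innerFibration : SSet.InnerFibration q
  exists_lift : ∀ (y : X _⦋0⦌) (f : S _⦋1⦌), S.δ 0 f = q.app _ y →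
    ∃ e : X _⦋1⦌, IsCartesianEdge q e ∧ X.δ 0 e = y ∧ q.app _ e = f

/-- A subcategory of an `∞`-category `E`: a simplicial subset whose inclusion is an inner
fibration. (These are the preimages of the subcategories of the homotopy category of `E`;
they need not be full, nor closed under equivalences.) -/
def IsSubcategory {E : SSet.{u}} (E₀ : E.Subcomplex) : Prop :=
  SSet.InnerFibration E₀.ι

/-- `ψ : x ⟶ z` is a factor of `φ : x ⟶ y` through `e : z ⟶ y` over `p`: there is a 2-simplex
exhibiting `φ` as a composite `e ∘ ψ`, lying over the degenerate 2-simplex that exhibits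
`p(φ)` as `p(φ) ∘ id`. In particular `p(e) = p(φ)` and `p(ψ)` is an identity. -/
def IsFactorThrough {E B : SSet.{u}} (p : E ⟶ B) (φ e ψ : E _⦋1⦌) : Prop :=
  ∃ σ : E _⦋2⦌, E.δ 0 σ = e ∧ E.δ 1 σ = φ ∧ E.δ 2 σ = ψ ∧
    p.app _ σ = B.σ 0 (p.app _ φ)

end CartFib

/-! Condition (ii) speaks only of factorizations over identities. `mem_of_comp_mem` extends one
direction to every 2-simplex `σ` whose edge `δ 0 σ` is `p`-cartesian and in `E₀`: choose a cartesian
lift `e'` of `p(δ 2 σ)` in `E₀`. Then `δ 2 σ` factors through `e'`, and `δ 1 σ` through the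
composite of `e'` with `δ 0 σ`, by the same edge `ψ` over an identity, so (ii) applied twice carries
membership from `δ 1 σ` to `δ 2 σ`. The composite is cartesian by `IsCartesianEdge.comp`.

Hence a `p`-cartesian edge of `E₀` is cartesian for the restriction: fill the horn in `E`; the
filler lies in `E₀`, by this cancellation in dimension 2 and by inner horns above. With (i) this
gives the fibration.

Conversely, compare an edge `e` cartesian for the restriction with a `p`-cartesian lift `e'` in `E₀`
of the same data. Both are cartesian for the restriction, so `e` is a retract of `e'`, witnessed by
one 3-simplex of `E₀`. Its image in `E` shows that `e` is `p`-cartesian, by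
`IsCartesianEdge.of_retract`.

`comp` and `of_retract` embed a lifting problem in a simplex with extra vertices, extend by
`liftsExtend_faces` through inner horns and outer horns ending in a known cartesian edge, and
restrict to a face. -/

namespace CartFib

open SSet

/-! ### Maps out of unions of subcomplexes. -/

section Gluing

variable {X Y Z : SSet.{u}}

lemma exists_desc_sup (K L : Y.Subcomplex) (f : (K : SSet.{u}) ⟶ X) (g : (L : SSet.{u}) ⟶ X)
    (h : ∀ (d : SimplexCategoryᵒᵖ) (x : Y.obj d) (hK : x ∈ K.obj d) (hL : x ∈ L.obj d),
      f.app d ⟨x, hK⟩ = g.app d ⟨x, hL⟩) :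
    ∃ k : ((K ⊔ L : Y.Subcomplex) : SSet.{u}) ⟶ X,
      Subcomplex.homOfLE le_sup_left ≫ k = f ∧ Subcomplex.homOfLE le_sup_right ≫ k = g := by
  have sq : Subcomplex.BicartSq (K ⊓ L) K L (K ⊔ L) := ⟨rfl, rfl⟩
  have hw : Subcomplex.homOfLE sq.le₁₂ ≫ f = Subcomplex.homOfLE sq.le₁₃ ≫ g := by
    ext d ⟨x, hx⟩
    exact h d x hx.1 hx.2
  exact ⟨sq.isPushout.desc f g hw, sq.isPushout.inl_desc f g hw, sq.isPushout.inr_desc f g hw⟩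

lemma hom_ext_sup {K L : Y.Subcomplex} {f g : ((K ⊔ L : Y.Subcomplex) : SSet.{u}) ⟶ X}
    (hK : Subcomplex.homOfLE le_sup_left ≫ f = Subcomplex.homOfLE (le_sup_left : K ≤ K ⊔ L) ≫ g)
    (hL : Subcomplex.homOfLE le_sup_right ≫ f =
      Subcomplex.homOfLE (le_sup_right : L ≤ K ⊔ L) ≫ g) : f = g := by
  have sq : Subcomplex.BicartSq (K ⊓ L) K L (K ⊔ L) := ⟨rfl, rfl⟩
  exact sq.isPushout.hom_ext hK hL

/-- A monomorphism identifies `Z` with its range, so compatibility need only be checked on the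
preimage of `K`; below, `Z` is a simplex and that preimage a horn. -/
lemma exists_desc_sup_range (K : Y.Subcomplex) (j : Z ⟶ Y) [Mono j] (f : (K : SSet.{u}) ⟶ X)
    (g : Z ⟶ X) (h : (K.preimage j).ι ≫ g = K.fromPreimage j ≫ f) :
    ∃ k : ((K ⊔ Subcomplex.range j : Y.Subcomplex) : SSet.{u}) ⟶ X,
      Subcomplex.homOfLE le_sup_left ≫ k = f ∧ Subcomplex.lift j le_sup_right ≫ k = g := by
  obtain ⟨k, hk₁, hk₂⟩ := exists_desc_sup K (Subcomplex.range j) f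
    (inv (Subcomplex.toRange j) ≫ g) (by
      rintro d _ hK ⟨y, rfl⟩
      have h₁ : (inv (Subcomplex.toRange j)).app d ⟨j.app d y, ⟨y, rfl⟩⟩ = y := by
        have := congr_fun (congr_arg (fun t ↦ (t.app d : _ → _)) (IsIso.hom_inv_id (Subcomplex.toRange j))) y
        exact this
      have h₂ := congr_fun (congr_arg (fun t ↦ (t.app d : _ → _)) h) ⟨y, hK⟩
      refine Eq.trans h₂.symm ?_
      change g.app d y = g.app d ((inv (Subcomplex.toRange j)).app d _)
      rw [h₁])
  refine ⟨k, hk₁, ?_⟩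
  have : Subcomplex.lift j le_sup_right =
    Subcomplex.toRange j ≫ Subcomplex.homOfLE (le_sup_right : Subcomplex.range j ≤ K ⊔ _) := rfl
  rw [this, Category.assoc, hk₂, IsIso.hom_inv_id_assoc]

end Gluing

/-! ### Subcomplexes of a simplex given by lower sets of vertex sets. -/

section Faces

variable {n : ℕ}

/-- The subcomplex of `Δ[n]` whose nondegenerate simplices are the faces in a lower set. -/
def faces (P : LowerSet (Finset (Fin (n + 1)))) : (Δ[n] : SSet.{u}).Subcomplex where
  obj U := {x | Finset.image (stdSimplex.objEquiv x).toOrderHom ⊤ ∈ P}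
  map {U V} i x hx := P.lower (by
    intro a ha
    simp only [Finset.mem_image] at ha ⊢
    obtain ⟨b, -, rfl⟩ := ha
    exact ⟨i.unop.toOrderHom b, by simp, rfl⟩) hx

lemma mem_faces_iff (P : LowerSet (Finset (Fin (n + 1)))) {U : SimplexCategoryᵒᵖ}
    (x : (Δ[n] : SSet.{u}).obj U) :
    x ∈ (faces P).obj U ↔ Finset.image (stdSimplex.objEquiv x).toOrderHom ⊤ ∈ P := Iff.rfl

lemma faces_mono {P Q : LowerSet (Finset (Fin (n + 1)))} (h : P ≤ Q) :
    faces.{u} P ≤ faces Q := fun _ _ hx ↦ h hx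

lemma face_le_faces_iff {s : Finset (Fin (n + 1))} (hs : s.Nonempty)
    (P : LowerSet (Finset (Fin (n + 1)))) : stdSimplex.face.{u} s ≤ faces P ↔ s ∈ P := by
  constructor
  · intro h
    obtain ⟨m, hm⟩ : ∃ m, s.card = m + 1 := ⟨s.card - 1, by have := hs.card_pos; omega⟩
    rw [stdSimplex.face_eq_ofSimplex s m (s.orderIsoOfFin hm), Subcomplex.ofSimplex_le_iff] at h
    refine P.lower ?_ h
    intro a ha
    simp only [Finset.mem_image]
    exact ⟨(s.orderIsoOfFin hm).symm ⟨a, ha⟩, by simp, congr_arg Subtype.val ((s.orderIsoOfFin hm).apply_symm_apply ⟨a, ha⟩)⟩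
  · intro h U x hx
    exact P.lower hx h

end Faces

/-! ### Extending partial lifts by successive horn fillings. -/

section Extension

variable {X S : SSet.{u}} {n : ℕ}

/-- Every partial lift on `K` of an `n`-simplex of `S` through `p` that sends the edges in `M` to
`p`-cartesian edges extends to `K'`. -/
def LiftsExtend (p : X ⟶ S) (M : Set ((Δ[n] : SSet.{u}) _⦋1⦌)) (K K' : (Δ[n] : SSet.{u}).Subcomplex) :
    Prop :=
  ∃ h : K ≤ K', ∀ (f : (K : SSet.{u}) ⟶ X) (τ : Δ[n] ⟶ S), f ≫ p = K.ι ≫ τ →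
    (∀ x ∈ M, ∃ hx : x ∈ K.obj (op ⦋1⦌), IsCartesianEdge p (f.app _ ⟨x, hx⟩)) →
    ∃ f' : (K' : SSet.{u}) ⟶ X, Subcomplex.homOfLE h ≫ f' = f ∧ f' ≫ p = K'.ι ≫ τ

/-- Partial lifts extend along every filling of the horn at `v` in the face `s`. -/
def FillableHorn (p : X ⟶ S) (M : Set ((Δ[n] : SSet.{u}) _⦋1⦌)) (s : Finset (Fin (n + 1)))
    (v : Fin (n + 1)) : Prop :=
  ∀ K : (Δ[n] : SSet.{u}).Subcomplex, (∀ w ∈ s, w ≠ v → stdSimplex.face (s.erase w) ≤ K) →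
    ¬ stdSimplex.face (s.erase v) ≤ K → LiftsExtend p M K (K ⊔ stdSimplex.face s)

variable {p : X ⟶ S} {M : Set ((Δ[n] : SSet.{u}) _⦋1⦌)}

lemma LiftsExtend.refl (K : (Δ[n] : SSet.{u}).Subcomplex) : LiftsExtend p M K K :=
  ⟨le_rfl, fun f _ hf _ ↦ ⟨f, rfl, hf⟩⟩

lemma LiftsExtend.trans {K K' K'' : (Δ[n] : SSet.{u}).Subcomplex}
    (h : LiftsExtend p M K K') (h' : LiftsExtend p M K' K'') : LiftsExtend p M K K'' := by
  obtain ⟨hle, h⟩ := h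
  obtain ⟨hle', h'⟩ := h'
  refine ⟨hle.trans hle', fun f τ hf hM ↦ ?_⟩
  obtain ⟨f', hf', hf'p⟩ := h f τ hf hM
  obtain ⟨f'', hf'', hf''p⟩ := h' f' τ hf'p (fun x hx ↦ by
    obtain ⟨hxK, hc⟩ := hM x hx
    refine ⟨hle _ hxK, ?_⟩
    subst hf'
    exact hc)
  exact ⟨f'', by rw [← hf', ← hf'']; rfl, hf''p⟩

/-- The inclusion of the face of `Δ[n]` spanned by a set of `m + 1` vertices. -/
noncomputable def faceMap (s : Finset (Fin (n + 1))) {m : ℕ} (hs : s.card = m + 1) :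
    (Δ[m] : SSet.{u}) ⟶ Δ[n] :=
  SSet.stdSimplex.map (SimplexCategory.Hom.mk (s.orderEmbOfFin hs).toOrderHom)

instance (s : Finset (Fin (n + 1))) {m : ℕ} (hs : s.card = m + 1) :
    Mono (faceMap.{u} s hs) := by
  have (U : SimplexCategoryᵒᵖ) : Mono ((faceMap.{u} s hs).app U) := by
    obtain ⟨d⟩ := U
    induction d using SimplexCategory.rec with | _ d
    rw [mono_iff_injective]
    intro x y h
    ext i : 1
    exact (s.orderEmbOfFin hs).injective (DFunLike.congr_fun (F := (Δ[n] : SSet.{u}) _⦋d⦌) h i)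
  exact NatTrans.mono_of_mono_app _

lemma range_faceMap (s : Finset (Fin (n + 1))) {m : ℕ} (hs : s.card = m + 1) :
    Subcomplex.range (faceMap.{u} s hs) = stdSimplex.face s := by
  rw [Subcomplex.range_eq_ofSimplex, stdSimplex.face_eq_ofSimplex s m (s.orderIsoOfFin hs)]
  rfl

/-- A subcomplex of a simplex that contains every facet but one is the horn, since anything not
inside the horn must contain the remaining facet. -/
lemma preimage_faceMap_eq_horn {s : Finset (Fin (n + 1))} {m : ℕ} (hs : s.card = m + 2)
    (i : Fin (m + 2)) {K : (Δ[n] : SSet.{u}).Subcomplex}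
    (hK : ∀ w ∈ s, w ≠ s.orderEmbOfFin hs i → stdSimplex.face (s.erase w) ≤ K)
    (hv : ¬ stdSimplex.face (s.erase (s.orderEmbOfFin hs i)) ≤ K) :
    K.preimage (faceMap s hs) = Λ[m + 1, i] := by
  apply le_antisymm
  · rw [subcomplex_le_horn_iff]
    refine fun h ↦ hv ?_
    rintro ⟨d⟩ x hx
    induction d using SimplexCategory.rec with | _ d
    rw [stdSimplex.mem_face_iff] at hx
    have hxs : x ∈ (Subcomplex.range (faceMap s hs)).obj _ := by
      rw [range_faceMap, stdSimplex.mem_face_iff]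
      exact fun j ↦ Finset.mem_of_mem_erase (hx j)
    obtain ⟨y, rfl⟩ := hxs
    refine h _ (?_ : y ∈ _)
    rw [stdSimplex.mem_face_iff]
    intro j
    have := Finset.ne_of_mem_erase (hx j)
    simp only [Finset.mem_compl, Finset.mem_singleton]
    rintro rfl
    exact this rfl
  · rw [horn_eq_iSup, iSup_le_iff]
    rintro ⟨k, hk⟩
    rintro ⟨d⟩ x hx
    induction d using SimplexCategory.rec with | _ d
    rw [stdSimplex.mem_face_iff] at hx
    refine hK (s.orderEmbOfFin hs k) (s.orderEmbOfFin_mem hs k) ?_ _ ?_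
    · simpa using hk
    · rw [stdSimplex.mem_face_iff]
      intro j
      rw [Finset.mem_erase]
      refine ⟨?_, s.orderEmbOfFin_mem hs _⟩
      have := hx j
      simp only [Finset.mem_compl, Finset.mem_singleton] at this
      exact fun h ↦ this ((s.orderEmbOfFin hs).injective h)

/-- `K` meets the face `s` exactly in a horn, so a lift on that simplex glues with the given one on
`K`. The lift may assume that horn edges landing in `M` are cartesian, as outer horns require. -/
lemma fillableHorn_of_exists_lift {s : Finset (Fin (n + 1))} {m : ℕ} (hs : s.card = m + 2)
    (i : Fin (m + 2))
    (hlift : ∀ (σ₀ : (Λ[m + 1, i] : SSet.{u}) ⟶ X) (τ : Δ[m + 1] ⟶ S),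
      σ₀ ≫ p = Λ[m + 1, i].ι ≫ τ →
      (∀ x : (Λ[m + 1, i] : SSet.{u}) _⦋1⦌, (faceMap s hs).app _ x.1 ∈ M →
        IsCartesianEdge p (σ₀.app _ x)) →
      ∃ σ : Δ[m + 1] ⟶ X, Λ[m + 1, i].ι ≫ σ = σ₀ ∧ σ ≫ p = τ) :
    FillableHorn p M s (s.orderEmbOfFin hs i) := by
  intro K hK hv
  refine ⟨le_sup_left, fun f τ hf hM ↦ ?_⟩
  have heq := preimage_faceMap_eq_horn hs i hK hv
  obtain ⟨σ, hσ, hσp⟩ := hlift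
    (Subcomplex.homOfLE heq.ge ≫ K.fromPreimage (faceMap s hs) ≫ f) (faceMap s hs ≫ τ) (by
      rw [Category.assoc, Category.assoc, hf]; rfl) (by
      intro x hx
      obtain ⟨_, hc⟩ := hM _ hx
      exact hc)
  obtain ⟨k, hk₁, hk₂⟩ := exists_desc_sup_range K (faceMap s hs) f σ (by
    have : (K.preimage (faceMap s hs)).ι = Subcomplex.homOfLE heq.le ≫ Λ[m + 1, i].ι := rfl
    rw [this, Category.assoc, hσ]
    rfl)
  rw [← range_faceMap s hs]
  refine ⟨k, hk₁, hom_ext_sup ?_ ?_⟩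
  · rw [← Category.assoc, hk₁, hf]
    rfl
  · rw [← cancel_epi (Subcomplex.toRange (faceMap s hs))]
    have : Subcomplex.toRange (faceMap s hs) ≫ Subcomplex.homOfLE le_sup_right ≫ k = σ := hk₂
    rw [← Category.assoc (Subcomplex.homOfLE _), ← Category.assoc, this, hσp]
    rfl

lemma fillableHorn_of_inner [hp : InnerFibration p] {s : Finset (Fin (n + 1))} {v a b : Fin (n + 1)}
    (ha : a ∈ s) (hv : v ∈ s) (hb : b ∈ s) (hav : a < v) (hvb : v < b) : FillableHorn p M s v := by
  obtain ⟨m, hm⟩ : ∃ m, s.card = m + 2 := ⟨s.card - 2, by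
    have : 1 < s.card := Finset.one_lt_card.2 ⟨a, ha, b, hb, (hav.trans hvb).ne⟩
    omega⟩
  obtain ⟨i, rfl⟩ := (s.orderIsoOfFin hm).surjective ⟨v, hv⟩ |>.imp (fun i hi ↦ congr_arg Subtype.val hi)
  obtain ⟨j, rfl⟩ := (s.orderIsoOfFin hm).surjective ⟨a, ha⟩ |>.imp (fun i hi ↦ congr_arg Subtype.val hi)
  obtain ⟨k, rfl⟩ := (s.orderIsoOfFin hm).surjective ⟨b, hb⟩ |>.imp (fun i hi ↦ congr_arg Subtype.val hi)
  have hji : j < i := (s.orderIsoOfFin hm).lt_iff_lt.1 hav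
  have hik : i < k := (s.orderIsoOfFin hm).lt_iff_lt.1 hvb
  refine fillableHorn_of_exists_lift hm i (fun σ₀ τ h _ ↦ ?_)
  have := hp.mem _ (horn_ι_mem_innerHornInclusions (i := i) (lt_of_le_of_lt (Fin.zero_le j) hji)
    (lt_of_lt_of_le hik (Fin.le_last k)))
  have sq : CommSq σ₀ Λ[m + 1, i].ι p τ := ⟨h⟩
  exact ⟨sq.lift, sq.fac_left, sq.fac_right⟩

/-- The last two vertices of `s` are `b` and `c`, so the marked edge is the last edge of the outer
horn; `a` ensures dimension at least 2. -/
lemma fillableHorn_of_cartesian {s : Finset (Fin (n + 1))} {a b c : Fin (n + 1)}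
    (ha : a ∈ s) (hb : b ∈ s) (hc : c ∈ s) (hab : a < b) (hbc : b < c)
    (hs : ∀ x ∈ s, x ≤ b ∨ x = c)
    (hM : stdSimplex.edge n b c hbc.le ∈ M) : FillableHorn p M s c := by
  obtain ⟨m, hm⟩ : ∃ m, s.card = m + 2 + 1 := ⟨s.card - 3, by
    have : 2 < s.card :=
      Finset.two_lt_card.2 ⟨a, ha, b, hb, c, hc, hab.ne, (hab.trans hbc).ne, hbc.ne⟩
    omega⟩
  have hlast : s.orderEmbOfFin hm (Fin.last (m + 2)) = c := by
    obtain ⟨i, hi⟩ := (s.orderIsoOfFin hm).surjective ⟨c, hc⟩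
    replace hi : s.orderEmbOfFin hm i = c := congr_arg Subtype.val hi
    refine le_antisymm ?_ (hi ▸ (s.orderEmbOfFin hm).monotone (Fin.le_last i))
    rcases hs _ (s.orderEmbOfFin_mem hm (Fin.last (m + 2))) with h | h
    exacts [h.trans hbc.le, h.le]
  have hpen : s.orderEmbOfFin hm (Fin.last (m + 1)).castSucc = b := by
    obtain ⟨i, hi⟩ := (s.orderIsoOfFin hm).surjective ⟨b, hb⟩
    replace hi : s.orderEmbOfFin hm i = b := congr_arg Subtype.val hi
    have hlt : i < Fin.last (m + 2) := by
      rwa [← (s.orderEmbOfFin hm).lt_iff_lt, hi, hlast]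
    refine le_antisymm ?_ (hi ▸ (s.orderEmbOfFin hm).monotone ?_)
    · refine (hs _ (s.orderEmbOfFin_mem hm _)).resolve_right (fun h ↦ ?_)
      rw [← hlast] at h
      exact (Fin.castSucc_lt_last _).ne ((s.orderEmbOfFin hm).injective h)
    · rw [Fin.lt_def] at hlt
      rw [Fin.le_def]
      simp at hlt ⊢
      omega
  rw [← hlast]
  refine fillableHorn_of_exists_lift hm _ (fun σ₀ τ h hσ₀ ↦ ?_)
  refine hσ₀ (lastEdge m) ?_ m σ₀ τ h rfl
  convert hM
  ext i : 1
  fin_cases i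
  exacts [hpen, hlast]

/-- The pairing argument: if toggling the vertex `v` preserves `Q \ P`, then partial lifts extend
from `P` to `Q` by successively filling the horns at `v` in the members of `Q \ P` that contain
`v`. -/
lemma liftsExtend_faces {P Q : LowerSet (Finset (Fin (n + 1)))} (v : Fin (n + 1)) (h_empty : ∅ ∈ P)
    (hPQ : P ≤ Q) (h_insert : ∀ s ∈ Q, s ∉ P → insert v s ∈ Q) (h_erase : ∀ s ∈ Q, s.erase v ∈ P → s ∈ P)
    (h_fill : ∀ s ∈ Q, s ∉ P → v ∈ s → FillableHorn p M s v) :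
    LiftsExtend p M (faces P) (faces Q) := by
  induction h : ((Q : Set (Finset (Fin (n + 1)))) \ P).ncard using Nat.strong_induction_on
    generalizing P with | _ N ih
  subst h
  by_cases hQP : Q ≤ P
  · rw [le_antisymm hPQ hQP]
    exact .refl _
  obtain ⟨s₀, hs₀Q, hs₀P⟩ := Set.not_subset.1 hQP
  have hne : ∃ s, s ∈ Q ∧ s ∉ P ∧ v ∈ s :=
    ⟨insert v s₀, h_insert _ hs₀Q hs₀P, fun h ↦ hs₀P (P.lower (Finset.subset_insert _ _) h),
      Finset.mem_insert_self _ _⟩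
  -- By minimality every facet of `s` containing `v` is already in `P`, while `h_erase` keeps the
  -- facet opposite `v` out. Filling this horn adds `s` and `s.erase v` together.
  obtain ⟨s, ⟨hsQ, hsP, hvs⟩, hmin⟩ := exists_minimalFor_of_wellFoundedLT
    (fun s ↦ s ∈ Q ∧ s ∉ P ∧ v ∈ s) Finset.card hne
  have hsv : s.erase v ∉ P := fun h ↦ hsP (h_erase s hsQ h)
  refine LiftsExtend.trans (K' := faces (P ⊔ LowerSet.Iic s)) ?_
    (ih _ ?_ (P := P ⊔ LowerSet.Iic s) (Or.inl h_empty) ?_ ?_ ?_ ?_ rfl)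
  · refine h_fill s hsQ hsP hvs _ (fun w hw hwv ↦ ?_) (fun h ↦ ?_)
    · rw [face_le_faces_iff ⟨v, Finset.mem_erase.2 ⟨hwv.symm, hvs⟩⟩]
      by_contra hP
      have h₁ := hmin ⟨Q.lower (Finset.erase_subset _ _) hsQ, hP, Finset.mem_erase.2 ⟨hwv.symm, hvs⟩⟩
        (Finset.card_le_card (Finset.erase_subset _ _))
      exact (Finset.card_erase_lt_of_mem hw).not_ge h₁
    · rcases (s.erase v).eq_empty_or_nonempty with h₀ | h₀
      · exact hsv (h₀ ▸ h_empty)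
      · exact hsv ((face_le_faces_iff h₀ P).1 h)
  · refine Set.ncard_lt_ncard ⟨?_, ?_⟩ (Set.toFinite _)
    · exact fun t ht ↦ ⟨ht.1, fun h ↦ ht.2 (Or.inl h)⟩
    · exact fun h ↦ (h ⟨hsQ, hsP⟩ : s ∈ _).2 (Or.inr (LowerSet.mem_Iic_iff.2 le_rfl))
  · exact sup_le hPQ (LowerSet.Iic_le.2 hsQ)
  · exact fun t ht h ↦ h_insert t ht (fun h' ↦ h (Or.inl h'))
  · rintro t ht (h | h)
    · exact Or.inl (h_erase t ht h)
    · refine Or.inr ?_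
      intro x hx
      by_cases hxv : x = v
      · exact hxv ▸ hvs
      · exact h (Finset.mem_erase.2 ⟨hxv, hx⟩)
  · exact fun t ht h ↦ h_fill t ht (fun h' ↦ h (Or.inl h'))

end Extension

/-! ### Collapsing a block of vertices, and sections of the collapse. -/

section StandardMaps

/-- The map of standard simplices given on vertices by a monotone function on natural numbers. -/
def natMap {a b : ℕ} (f : ℕ → ℕ) (hf : Monotone f) (hb : ∀ i ≤ a, f i ≤ b) :
    (Δ[a] : SSet.{u}) ⟶ Δ[b] :=
  SSet.stdSimplex.map (SimplexCategory.Hom.mk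
    ⟨fun i : Fin (a + 1) ↦ (⟨f i, Nat.lt_succ_of_le (hb i (Nat.le_of_lt_succ i.2))⟩ : Fin (b + 1)),
      fun _ _ h ↦ hf h⟩)

variable (n k : ℕ)

/-- The map `Δ[n + 2 + k] ⟶ Δ[n + 2]` sending the vertices `n + 1, …, n + 1 + k` to `n + 1`. -/
def collapse : (Δ[n + 2 + k] : SSet.{u}) ⟶ Δ[n + 2] :=
  natMap (fun i ↦ max (min i (n + 1)) (i - k)) (fun _ _ h ↦ by simp only; omega) (fun _ h ↦ by omega)

/-- The map `Δ[n + 2 + k] ⟶ Δ[1 + k]` sending the vertices `0, …, n + 1` to `0`. -/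
def tail : (Δ[n + 2 + k] : SSet.{u}) ⟶ Δ[1 + k] :=
  natMap (fun i ↦ i - (n + 1)) (fun _ _ h ↦ by simp only; omega) (fun _ h ↦ by omega)

/-- The map `Δ[n + 2 + k] ⟶ Δ[1]` sending only the last vertex to `1`. -/
def toEdge : (Δ[n + 2 + k] : SSet.{u}) ⟶ Δ[1] :=
  natMap (fun i ↦ i - (n + 1 + k)) (fun _ _ h ↦ by simp only; omega) (fun _ h ↦ by omega)

/-- The map `Δ[n + 2] ⟶ Δ[n + 2 + k]` that skips the vertices `m + 1, …, m + k`. -/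
def skip (m : ℕ) : (Δ[n + 2] : SSet.{u}) ⟶ Δ[n + 2 + k] :=
  natMap (fun i ↦ if i ≤ m then i else i + k)
    (fun _ _ h ↦ by simp only; split_ifs <;> omega) (fun _ h ↦ by split_ifs <;> omega)

/-- The inclusion of the last edge of the horn `Λ[n + 2, n + 2]`. -/
def lastEdgeMap : (Δ[1] : SSet.{u}) ⟶ Λ[n + 2, Fin.last (n + 2)] :=
  SSet.yonedaEquiv.symm (lastEdge n)

variable {n k}

lemma lastEdgeMap_comp {X : SSet.{u}} (σ₀ : (Λ[n + 2, Fin.last (n + 2)] : SSet.{u}) ⟶ X) :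
    lastEdgeMap n ≫ σ₀ = SSet.yonedaEquiv.symm (σ₀.app _ (lastEdge n)) :=
  SSet.yonedaEquiv_symm_comp _ _

/-- The section keeps one vertex of the collapsed block: the last for `m = n` (used for retracts),
the first for `m = n + 1` (used for composites). -/
lemma skip_comp_collapse {m : ℕ} (h₁ : n ≤ m) (h₂ : m ≤ n + 1) :
    skip n k m ≫ collapse.{u} n k = 𝟙 _ := by
  apply SSet.yonedaEquiv.injective
  ext i : 1
  apply Fin.ext
  change max (min (if (i : ℕ) ≤ m then (i : ℕ) else i + k) (n + 1))
    ((if (i : ℕ) ≤ m then (i : ℕ) else i + k) - k) = i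
  have : (i : ℕ) ≤ n + 2 := Nat.le_of_lt_succ i.2
  split_ifs <;> omega

/-- Vertices beyond `n` collapse into the last edge, which is where the horn must agree with the
added simplex. -/
lemma collapse_app_eq {d : ℕ} (x : (Δ[n + 2 + k] : SSet.{u}) _⦋d⦌) (hx : ∀ i, n < (x i : ℕ)) :
    (collapse n k).app _ x = ((lastEdgeMap n).app _ ((toEdge n k).app _ x)).1 := by
  apply SSet.stdSimplex.ext
  intro i
  have h := hx i
  have h' := (x i).2
  apply Fin.ext
  change max (min (x i : ℕ) (n + 1)) ((x i : ℕ) - k) =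
    (![(Fin.last (n + 1)).castSucc, Fin.last (n + 2)]
      ⟨(x i : ℕ) - (n + 1 + k), _⟩ : Fin (n + 3)).val
  rcases Nat.lt_or_ge (x i : ℕ) (n + 2 + k) with h₁ | h₁
  · have h₂ : (x i : ℕ) - (n + 1 + k) = 0 := by omega
    simp only [h₂]
    simp
    omega
  · have h₂ : (x i : ℕ) - (n + 1 + k) = 1 := by omega
    simp only [h₂]
    simp
    omega

lemma collapse_comp_app_eq {S : SSet.{u}} (τ : Δ[n + 2] ⟶ S) {d : ℕ}
    (x : (Δ[n + 2 + k] : SSet.{u}) _⦋d⦌) (hx : ∀ i, n < (x i : ℕ)) :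
    (collapse n k ≫ τ).app _ x =
      (lastEdgeMap n ≫ Λ[n + 2, Fin.last (n + 2)].ι ≫ τ).app _ ((toEdge n k).app _ x) :=
  congr_arg (τ.app _) (collapse_app_eq x hx)

lemma app_collapse_eq {X : SSet.{u}} (σ₀ : (Λ[n + 2, Fin.last (n + 2)] : SSet.{u}) ⟶ X) {d : ℕ}
    (x : (Δ[n + 2 + k] : SSet.{u}) _⦋d⦌) (hx : ∀ i, n < (x i : ℕ))
    (h : (collapse n k).app _ x ∈ (Λ[n + 2, Fin.last (n + 2)] : (Δ[n + 2] : SSet.{u}).Subcomplex).obj _) :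
    σ₀.app _ ⟨(collapse n k).app _ x, h⟩ = (lastEdgeMap n ≫ σ₀).app _ ((toEdge n k).app _ x) :=
  congr_arg (σ₀.app _) (Subtype.ext (collapse_app_eq x hx))

lemma app_congr {X Y : SSet.{u}} {f g : X ⟶ Y} (h : f = g) {d : SimplexCategoryᵒᵖ} (x : X.obj d) :
    f.app d x = g.app d x := by
  rw [h]

end StandardMaps

/-! ### The lower sets used as stages of the extensions. -/

section LowerSets

variable {n : ℕ}

/-- The sets of vertices that do not contain `b`. -/
def avoiding (b : Fin (n + 1)) : LowerSet (Finset (Fin (n + 1))) where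
  carrier := {t | b ∉ t}
  lower' _ _ h h₁ h₂ := h₁ (h h₂)

/-- The sets of vertices that do not contain all of `s`. -/
def missing (s : Finset (Fin (n + 1))) : LowerSet (Finset (Fin (n + 1))) where
  carrier := {t | ¬ s ⊆ t}
  lower' _ _ h h₁ h₂ := h₁ (h₂.trans h)

/-- The sets of vertices larger than `m`. -/
def above (m : ℕ) : LowerSet (Finset (Fin (n + 1))) where
  carrier := {t | ∀ x ∈ t, m < x.val}
  lower' _ _ h h₁ x hx := h₁ x (h hx)

@[simp] lemma mem_avoiding {b : Fin (n + 1)} {t : Finset (Fin (n + 1))} :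
    t ∈ avoiding b ↔ b ∉ t := Iff.rfl

@[simp] lemma mem_missing {s t : Finset (Fin (n + 1))} : t ∈ missing s ↔ ¬ s ⊆ t := Iff.rfl

@[simp] lemma mem_above {m : ℕ} {t : Finset (Fin (n + 1))} :
    t ∈ above m ↔ ∀ x ∈ t, m < x.val := Iff.rfl

lemma mem_faces_avoiding {b : Fin (n + 1)} {d : ℕ} (x : (Δ[n] : SSet.{u}) _⦋d⦌) :
    x ∈ (faces (avoiding b)).obj (op ⦋d⦌) ↔ ∀ i, x i ≠ b := by
  rw [mem_faces_iff, mem_avoiding, Finset.mem_image]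
  simp

lemma mem_faces_above {m : ℕ} {d : ℕ} (x : (Δ[n] : SSet.{u}) _⦋d⦌) :
    x ∈ (faces (above m)).obj (op ⦋d⦌) ↔ ∀ i, m < (x i : ℕ) := by
  rw [mem_faces_iff, mem_above]
  simp

lemma mem_faces_missing {s : Finset (Fin (n + 1))} {d : ℕ} (x : (Δ[n] : SSet.{u}) _⦋d⦌) :
    x ∈ (faces (missing s)).obj (op ⦋d⦌) ↔ ∃ a ∈ s, ∀ i, x i ≠ a := by
  rw [mem_faces_iff, mem_missing, Finset.not_subset]
  simp

end LowerSets

/-! ### Composites of cartesian edges. -/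

section Composite

variable {X S : SSet.{u}} {n : ℕ}

lemma collapse_mem_horn {k : ℕ} {P : LowerSet (Finset (Fin (n + 2 + k + 1)))}
    (hP : ∀ t ∈ P, ∃ j : Fin (n + 2), ∀ i ∈ t, max (min (i : ℕ) (n + 1)) (i - k) ≠ j) :
    Subcomplex.range ((faces.{u} P).ι ≫ collapse n k) ≤ Λ[n + 2, Fin.last (n + 2)] := by
  rintro ⟨d⟩ _ ⟨⟨x, hx⟩, rfl⟩
  induction d using SimplexCategory.rec with | _ d
  obtain ⟨j, hj⟩ := hP _ hx
  rw [mem_horn_iff_notMem_range]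
  refine ⟨j.castSucc, (Fin.castSucc_lt_last j).ne, ?_⟩
  rintro ⟨i, hi⟩
  refine hj (x i) (Finset.mem_image.2 ⟨i, by simp, rfl⟩) ?_
  exact congr_arg Fin.val hi

lemma exists_lift_of_top {K : (Δ[n] : SSet.{u}).Subcomplex} {p : X ⟶ S} {M} (h : LiftsExtend p M K ⊤)
    (f : (K : SSet.{u}) ⟶ X) (τ : Δ[n] ⟶ S) (hf : f ≫ p = K.ι ≫ τ)
    (hM : ∀ x ∈ M, ∃ hx : x ∈ K.obj (op ⦋1⦌), IsCartesianEdge p (f.app _ ⟨x, hx⟩)) :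
    ∃ f' : Δ[n] ⟶ X, K.ι ≫ f' = f ∧ f' ≫ p = τ := by
  obtain ⟨_, h⟩ := h
  obtain ⟨f', h₁, h₂⟩ := h f τ hf hM
  refine ⟨(Subcomplex.topIso _).inv ≫ f', ?_, ?_⟩
  · rw [← h₁]; rfl
  · rw [Category.assoc, h₂]; rfl

/-- On `P` the extension is `σ₀` after `collapse`, and `skip` is a section of `collapse`, so
restricting along `skip` recovers `σ₀`. -/
lemma skip_comp_eq_of_collapse {k m : ℕ} (h₁ : n ≤ m) (h₂ : m ≤ n + 1)
    {P Q R : LowerSet (Finset (Fin (n + 2 + k + 1)))}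
    {σ₀ : (Λ[n + 2, Fin.last (n + 2)] : SSet.{u}) ⟶ X}
    (hP : Subcomplex.range ((faces.{u} P).ι ≫ collapse n k) ≤ Λ[n + 2, Fin.last (n + 2)])
    (hR : P ⊔ Q ≤ R) {f : (faces (P ⊔ Q) : SSet.{u}) ⟶ X} {f' : (faces R : SSet.{u}) ⟶ X}
    (hf : Subcomplex.homOfLE (faces_mono le_sup_left) ≫ f = Subcomplex.lift _ hP ≫ σ₀)
    (hf' : Subcomplex.homOfLE (faces_mono hR) ≫ f' = f)
    (hskip : Subcomplex.range (Λ[n + 2, Fin.last (n + 2)].ι ≫ skip.{u} n k m) ≤ faces P)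
    (hskip' : Subcomplex.range (skip.{u} n k m) ≤ faces R) :
    Λ[n + 2, Fin.last (n + 2)].ι ≫ Subcomplex.lift _ hskip' ≫ f' = σ₀ := by
  trans Subcomplex.lift _ hskip ≫ Subcomplex.homOfLE (faces_mono le_sup_left) ≫ f
  · rw [← hf']; rfl
  · rw [hf, ← Category.assoc]
    convert Category.id_comp _
    rw [← cancel_mono (Subcomplex.ι _)]
    exact congr_arg (Λ[n + 2, Fin.last (n + 2)].ι ≫ ·) (skip_comp_collapse.{u} h₁ h₂)

lemma erase_mem_missing_iff {s t : Finset (Fin (n + 1))} {v : Fin (n + 1)} (hv : v ∉ s) :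
    t.erase v ∈ missing s ↔ t ∈ missing s := by
  rw [mem_missing, mem_missing, Finset.subset_erase]
  simp [hv]

lemma insert_mem_missing {s t : Finset (Fin (n + 1))} {v : Fin (n + 1)} (hv : v ∉ s)
    (ht : t ∈ missing s) : insert v t ∈ missing s := by
  rw [mem_missing] at ht ⊢
  rwa [Finset.subset_insert_iff_of_notMem hv]

lemma erase_mem_above_iff {m : ℕ} {t : Finset (Fin (n + 1))} {v : Fin (n + 1)} (hv : m < v) :
    t.erase v ∈ above m ↔ t ∈ above m := by
  refine ⟨fun h x hx ↦ ?_, fun h ↦ (above m).lower (Finset.erase_subset _ _) h⟩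
  by_cases hxv : x = v
  · rwa [hxv]
  · exact h x (Finset.mem_erase.2 ⟨hxv, hx⟩)

lemma erase_mem_avoiding_iff {b v : Fin (n + 1)} {t : Finset (Fin (n + 1))} (hv : b ≠ v) :
    t.erase v ∈ avoiding b ↔ t ∈ avoiding b := by
  simp [hv]

lemma not_mem_above_iff {m : ℕ} {t : Finset (Fin (n + 1))} :
    t ∉ above m ↔ ∃ x ∈ t, (x : ℕ) ≤ m := by
  simp

/-- Insert the middle vertex `b` of `σ` between the last two vertices `a`, `c` of the horn. With the
horn off `b` and `σ` on `a, b, c`, extend to the whole simplex; the facet opposite `b` solves the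
problem. -/
theorem IsCartesianEdge.comp {p : X ⟶ S} [InnerFibration p] [Quasicategory S] {σ : X _⦋2⦌}
    (h₀ : IsCartesianEdge p (X.δ 0 σ)) (h₂ : IsCartesianEdge p (X.δ 2 σ)) :
    IsCartesianEdge p (X.δ 1 σ) := by
  intro n σ₀ τ hτ hσ₀
  let a : Fin (n + 2 + 1 + 1) := ⟨n + 1, by omega⟩
  let b : Fin (n + 2 + 1 + 1) := ⟨n + 2, by omega⟩
  let c : Fin (n + 2 + 1 + 1) := ⟨n + 3, by omega⟩
  have hab : a < b := Fin.mk_lt_mk.2 (by omega)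
  have hbc : b < c := Fin.mk_lt_mk.2 (by omega)
  have ha : n < (a : ℕ) := Nat.lt_succ_self n
  have hlow (x : Fin (n + 2 + 1 + 1)) (hx : (x : ℕ) ≤ n) : x < a :=
    Fin.lt_def.2 (Nat.lt_succ_of_le hx)
  let A : Finset (Fin (n + 2 + 1 + 1)) := Finset.univ.filter (fun x ↦ x.val ≤ n)
  have hA (x : Fin (n + 2 + 1 + 1)) : x ∈ insert a A ↔ x ≤ a := by
    simp only [A, a, Finset.mem_insert, Finset.mem_filter, Finset.mem_univ, true_and, Fin.le_def,
      Fin.ext_iff]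
    omega
  let s₂ : (Δ[2] : SSet.{u}) ⟶ X := SSet.yonedaEquiv.symm σ
  have hedge : lastEdgeMap n ≫ σ₀ = stdSimplex.δ 1 ≫ s₂ := by
    rw [lastEdgeMap_comp, hσ₀, stdSimplex.δ_comp_yonedaEquiv_symm]
  have htail (d : ℕ) (x : (Δ[n + 2 + 1] : SSet.{u}) _⦋d⦌) (hx : ∀ i, n < (x i : ℕ)) (hb : ∀ i, x i ≠ b) :
      (tail n 1).app _ x = (stdSimplex.δ (1 : Fin 3)).app _ ((toEdge n 1).app _ x) := by
    apply SSet.stdSimplex.ext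
    intro i
    apply Fin.ext
    change (x i : ℕ) - (n + 1) = ((1 : Fin 3).succAbove ⟨(x i : ℕ) - (n + 1 + 1), _⟩ : Fin 3).val
    have h₁ := hx i
    have h₂ : (x i : ℕ) ≠ n + 2 := fun h ↦ hb i (Fin.ext h)
    have h₃ := (x i).2
    have h₄ : (x i : ℕ) = n + 1 ∨ (x i : ℕ) = n + 3 := by omega
    rcases h₄ with h₄ | h₄ <;> simp [h₄, Fin.succAbove]
  -- The base simplex must be enlarged first: it is known off `b` and on `a, b, c`, and inner horns
  -- at `a` suffice for the rest.
  obtain ⟨τ', hτ'₁, hτ'₂⟩ : ∃ τ' : Δ[n + 2 + 1] ⟶ S,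
      (faces (avoiding b)).ι ≫ τ' = (faces (avoiding b)).ι ≫ collapse n 1 ≫ τ ∧
      (faces (above n)).ι ≫ τ' = (faces (above n)).ι ≫ tail n 1 ≫ s₂ ≫ p := by
    obtain ⟨f, hf₁, hf₂⟩ := exists_desc_sup (faces (avoiding b)) (faces (above n))
      ((faces (avoiding b)).ι ≫ collapse n 1 ≫ τ) ((faces (above n)).ι ≫ tail n 1 ≫ s₂ ≫ p) (by
        rintro ⟨d⟩ x hK hL
        induction d using SimplexCategory.rec with | _ d
        rw [mem_faces_avoiding] at hK
        rw [mem_faces_above] at hL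
        refine (collapse_comp_app_eq (n := n) (k := 1) τ x hL).trans ?_
        refine Eq.trans ?_ (congr_arg ((s₂ ≫ p).app _) (htail d x hL hK)).symm
        have := congr_arg (· ≫ p) hedge
        simp only [Category.assoc, hτ] at this
        exact app_congr this _)
    have hext : LiftsExtend (Limits.terminal.from S) ∅ (faces (avoiding b ⊔ above n)) (faces ⊤) := by
      refine liftsExtend_faces a (Or.inl (by simp)) le_top (fun _ _ _ ↦ trivial) ?_ ?_
      · rintro s - (hs | hs)
        · exact Or.inl ((erase_mem_avoiding_iff hab.ne').1 hs)
        · exact Or.inr ((erase_mem_above_iff ha).1 hs)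
      · intro s _ hs has
        rw [LowerSet.mem_sup_iff, not_or, not_mem_above_iff, mem_avoiding, not_not] at hs
        obtain ⟨hbs, x, hxs, hx⟩ := hs
        exact fillableHorn_of_inner hxs has hbs (hlow x hx) hab
    obtain ⟨τ', h, -⟩ := exists_lift_of_top hext f (Limits.terminal.from _) (Subsingleton.elim _ _) (by simp)
    exact ⟨τ', by rw [← hf₁, ← h]; rfl, by rw [← hf₂, ← h]; rfl⟩
  -- This is the horn at `c` inside the facet opposite `b`, as `insert a A` consists of the vertices
  -- up to `a`.
  let P : LowerSet (Finset (Fin (n + 2 + 1 + 1))) := avoiding b ⊓ missing (insert a A)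
  have hP : Subcomplex.range ((faces.{u} P).ι ≫ collapse n 1) ≤ Λ[n + 2, Fin.last (n + 2)] := by
    refine collapse_mem_horn (k := 1) (fun t ht ↦ ?_)
    obtain ⟨hbt, ht⟩ := ht
    obtain ⟨y, hy, hyt⟩ := Finset.not_subset.1 ht
    have hya : (y : ℕ) ≤ n + 1 := (hA y).1 hy
    refine ⟨⟨y, by omega⟩, fun i hi h ↦ ?_⟩
    have h₁ : (i : ℕ) ≠ n + 2 := fun h ↦ hbt (Fin.ext (a := i) (b := b) h ▸ hi)
    have h₂ : (i : ℕ) ≠ y := fun h ↦ hyt (Fin.ext h ▸ hi)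
    have h₃ := i.2
    simp only at h
    omega
  obtain ⟨f, hf₁, hf₂⟩ := exists_desc_sup (faces P) (faces (above n))
    (Subcomplex.lift _ hP ≫ σ₀) ((faces (above n)).ι ≫ tail n 1 ≫ s₂) (by
        rintro ⟨d⟩ x hK hL
        induction d using SimplexCategory.rec with | _ d
        rw [mem_faces_above] at hL
        refine (app_collapse_eq (n := n) (k := 1) σ₀ x hL _).trans ?_
        refine Eq.trans ?_
          (congr_arg (s₂.app _) (htail d x hL ((mem_faces_avoiding x).1 hK.1))).symm
        exact app_congr hedge _)
  have hf : f ≫ p = (faces (P ⊔ above n)).ι ≫ τ' := by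
    refine hom_ext_sup ?_ ?_
    · rw [← Category.assoc, hf₁, Category.assoc, hτ]
      exact congr_arg (Subcomplex.homOfLE (faces_mono (inf_le_left : P ≤ avoiding b)) ≫ ·) hτ'₁.symm
    · rw [← Category.assoc, hf₂]
      exact hτ'₂.symm
  let M : Set ((Δ[n + 2 + 1] : SSet.{u}) _⦋1⦌) :=
    {stdSimplex.edge _ b c hbc.le, stdSimplex.edge _ a b hab.le}
  have hM : ∀ x ∈ M, ∃ hx : x ∈ (faces (P ⊔ above n)).obj (op ⦋1⦌), IsCartesianEdge p (f.app _ ⟨x, hx⟩) := by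
    have key (x : (Δ[n + 2 + 1] : SSet.{u}) _⦋1⦌) (hx : ∀ i, n < (x i : ℕ)) :
      ∃ hx : x ∈ (faces (P ⊔ above n)).obj (op ⦋1⦌), f.app _ ⟨x, hx⟩ = s₂.app _ ((tail n 1).app _ x) :=
      ⟨Or.inr ((mem_faces_above x).2 hx), app_congr hf₂ ⟨x, (mem_faces_above x).2 hx⟩⟩
    have hδ (i : Fin 3) (e : (Δ[n + 2 + 1] : SSet.{u}) _⦋1⦌)
        (he : (tail n 1).app _ e = stdSimplex.objEquiv.symm (SimplexCategory.δ i)) :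
        s₂.app _ ((tail n 1).app _ e) = X.δ i σ := by
      rw [he]; rfl
    rintro x (rfl | rfl)
    · obtain ⟨hx, h⟩ := key (stdSimplex.edge _ b c hbc.le) (by
        intro i; fin_cases i <;> [exact ha.trans hab; exact (ha.trans hab).trans hbc])
      refine ⟨hx, ?_⟩
      rw [h, hδ 0]
      · exact h₀
      · ext i : 1
        apply Fin.ext
        fin_cases i
        · change n + 2 - (n + 1) = 1
          omega
        · change n + 3 - (n + 1) = 2
          omega
    · obtain ⟨hx, h⟩ := key (stdSimplex.edge _ a b hab.le) (by
        intro i; fin_cases i <;> [exact ha; exact ha.trans hab])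
      refine ⟨hx, ?_⟩
      rw [h, hδ 2]
      · exact h₂
      · ext i : 1
        apply Fin.ext
        fin_cases i
        · change n + 1 - (n + 1) = 0
          omega
        · change n + 2 - (n + 1) = 1
          omega
  have hext : LiftsExtend p M (faces (P ⊔ above n)) (faces ⊤) := by
    have hcA : c ∉ insert a A := fun h ↦ ((hA c).1 h).not_gt (hab.trans hbc)
    have hbA : b ∉ insert a A := fun h ↦ ((hA b).1 h).not_gt hab
    -- Sets omitting a vertex up to `a` come from outer horns at `c` ending in `b → c`. The others
    -- come from horns at `b`: inner if `c` is present, otherwise ending in `a → b`.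
    refine LiftsExtend.trans (K' := faces (P ⊔ above n ⊔ missing (insert a A)))
      (liftsExtend_faces c ?_ le_sup_left ?_ ?_ ?_)
      (liftsExtend_faces b ?_ le_top (fun _ _ _ ↦ trivial) ?_ ?_)
    · exact Or.inr (by simp)
    · rintro s (hs | hs) hs'
      · exact (hs' hs).elim
      · exact Or.inr (insert_mem_missing hcA hs)
    · rintro s (hs | hs) (hs' | hs')
      · exact hs
      · exact hs
      · exact Or.inl ⟨(erase_mem_avoiding_iff hbc.ne).1 hs'.1, hs⟩
      · exact Or.inr ((erase_mem_above_iff (ha.trans (hab.trans hbc))).1 hs')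
    · rintro s (hs | hs) hs' hcs
      · exact (hs' hs).elim
      · rw [LowerSet.mem_sup_iff, not_or, not_mem_above_iff] at hs'
        obtain ⟨hs', x, hxs, hx⟩ := hs'
        have hbs : b ∈ s := by
          by_contra hbs
          exact hs' ⟨hbs, hs⟩
        refine fillableHorn_of_cartesian hxs hbs hcs ((hlow x hx).trans hab) hbc (fun y _ ↦ ?_)
          (Or.inl rfl)
        have := y.2
        simp only [b, c, Fin.le_def, Fin.ext_iff]
        omega
    · exact Or.inl (Or.inr (by simp))
    · rintro s - ((hs | hs) | hs)
      · exact Or.inr ((erase_mem_missing_iff hbA).1 hs.2)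
      · exact Or.inl (Or.inr ((erase_mem_above_iff (ha.trans hab)).1 hs))
      · exact Or.inr ((erase_mem_missing_iff hbA).1 hs)
    · intro s _ hs hbs
      rw [LowerSet.mem_sup_iff, not_or, mem_missing, not_not] at hs
      have has : a ∈ s := hs.2 (Finset.mem_insert_self _ _)
      have h0s : 0 ∈ s := hs.2 ((hA 0).2 (Fin.zero_le _))
      have h0a : 0 < a := hlow 0 (Nat.zero_le _)
      by_cases hcs : c ∈ s
      · exact fillableHorn_of_inner has hbs hcs hab hbc
      · refine fillableHorn_of_cartesian h0s has hbs h0a hab (fun y hy ↦ ?_) (Or.inr rfl)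
        have h₁ := y.2
        have h₂ : (y : ℕ) ≠ n + 3 := fun h ↦ hcs (Fin.ext (a := y) (b := c) h ▸ hy)
        simp only [a, b, Fin.le_def, Fin.ext_iff]
        omega
  obtain ⟨_, hext⟩ := hext
  obtain ⟨f', hf', hf'p⟩ := hext f τ' hf hM
  have hskip : Subcomplex.range (skip.{u} n 1 (n + 1)) ≤ faces (avoiding b) := by
    rintro ⟨d⟩ _ ⟨x, rfl⟩
    induction d using SimplexCategory.rec with | _ d
    refine (mem_faces_avoiding _).2 (fun i hi ↦ ?_)
    have : (if (x i : ℕ) ≤ n + 1 then (x i : ℕ) else x i + 1) = n + 2 := congr_arg Fin.val hi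
    split_ifs at this <;> omega
  have hskip' : Subcomplex.range (Λ[n + 2, Fin.last (n + 2)].ι ≫ skip.{u} n 1 (n + 1)) ≤ faces P := by
    refine fun U x hx ↦ ⟨hskip U (?_ : x ∈ _), ?_⟩
    · obtain ⟨x, rfl⟩ := hx
      exact ⟨x.1, rfl⟩
    obtain ⟨d⟩ := U
    induction d using SimplexCategory.rec with | _ d
    obtain ⟨⟨x, hxΛ⟩, rfl⟩ := hx
    obtain ⟨j, hj, hjx⟩ := (mem_horn_iff_notMem_range _ _).1 hxΛ
    have hj' := Fin.lt_last_iff_ne_last.2 hj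
    refine (mem_faces_missing _).2 ⟨⟨j, by omega⟩, (hA _).2 (Nat.le_of_lt_succ hj'), ?_⟩
    intro i hi
    have : (if (x i : ℕ) ≤ n + 1 then (x i : ℕ) else x i + 1) = j := congr_arg Fin.val hi
    refine hjx ⟨i, Fin.ext ?_⟩
    have := Fin.lt_def.1 hj'
    simp at this
    split_ifs at * <;> omega
  refine ⟨Subcomplex.lift (B := faces ⊤) (skip n 1 (n + 1)) (fun _ _ _ ↦ trivial) ≫ f',
    skip_comp_eq_of_collapse n.le_succ le_rfl hP le_top hf₁ hf' hskip' _, ?_⟩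
  · rw [Category.assoc, hf'p]
    have := congr_arg (Subcomplex.lift _ hskip ≫ ·) hτ'₁
    refine Eq.trans this ?_
    have := congr_arg (· ≫ τ) (skip_comp_collapse.{u} (n := n) (k := 1) n.le_succ le_rfl)
    exact this

end Composite

/-! ### Retracts of cartesian edges. -/

section Retract

variable {X S : SSet.{u}} {n : ℕ}

lemma insert_mem_avoiding {b v : Fin (n + 1)} {t : Finset (Fin (n + 1))} (hv : b ≠ v)
    (ht : t ∈ avoiding b) : insert v t ∈ avoiding b := by
  rw [mem_avoiding] at ht ⊢
  simp [hv, ht]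

/-- Call the vertices of `ω` `a, b, a', c`: the edge `a → a'` is degenerate, `a → c` and `a' → c`
are `e`, and `b → c` is cartesian. Copy the horn onto both `a` and `a'`, lift to `b` using `b → c`,
then compose with `b → a'`; the face on `0, …, n, a', c` is the solution. -/
theorem IsCartesianEdge.of_retract {p : X ⟶ S} [InnerFibration p] {ω : X _⦋3⦌} {e : X _⦋1⦌}
    (hω : X.δ 1 ω = X.σ 0 e) (hωp : p.app _ ω = S.σ 0 (S.σ 0 (p.app _ e)))
    (he' : IsCartesianEdge p (X.δ 1 (X.δ 0 ω))) : IsCartesianEdge p e := by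
  intro n σ₀ τ hτ hσ₀
  let a : Fin (n + 2 + 2 + 1) := ⟨n + 1, by omega⟩
  let b : Fin (n + 2 + 2 + 1) := ⟨n + 2, by omega⟩
  let a' : Fin (n + 2 + 2 + 1) := ⟨n + 3, by omega⟩
  let c : Fin (n + 2 + 2 + 1) := ⟨n + 4, by omega⟩
  have hab : a < b := Fin.mk_lt_mk.2 (by omega)
  have hba' : b < a' := Fin.mk_lt_mk.2 (by omega)
  have ha'c : a' < c := Fin.mk_lt_mk.2 (by omega)
  have hbc : b < c := hba'.trans ha'c
  have ha : n < (a : ℕ) := Nat.lt_succ_self n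
  have hlow (x : Fin (n + 2 + 2 + 1)) (hx : (x : ℕ) ≤ n) : x < a :=
    Fin.lt_def.2 (Nat.lt_succ_of_le hx)
  let A : Finset (Fin (n + 2 + 2 + 1)) := Finset.univ.filter (fun x ↦ x.val ≤ n)
  have hA (x : Fin (n + 2 + 2 + 1)) : x ∈ A ↔ (x : ℕ) ≤ n := by simp [A]
  have haA : a ∉ A := fun h ↦ ((hA a).1 h).not_gt ha
  have hbA : b ∉ A := fun h ↦ ((hA b).1 h).not_gt (ha.trans hab)
  have hcA : c ∉ A := fun h ↦ ((hA c).1 h).not_gt (ha.trans (hab.trans hbc))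
  let w : (Δ[3] : SSet.{u}) ⟶ X := SSet.yonedaEquiv.symm ω
  have hw : stdSimplex.δ 1 ≫ w = stdSimplex.σ 0 ≫ SSet.yonedaEquiv.symm e := by
    rw [stdSimplex.δ_comp_yonedaEquiv_symm, hω, stdSimplex.σ_comp_yonedaEquiv_symm]
  have hwp : w ≫ p = stdSimplex.σ 0 ≫ stdSimplex.σ 0 ≫ SSet.yonedaEquiv.symm e ≫ p := by
    rw [SSet.yonedaEquiv_symm_comp, SSet.yonedaEquiv_symm_comp, hωp,
      stdSimplex.σ_comp_yonedaEquiv_symm, stdSimplex.σ_comp_yonedaEquiv_symm]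
  have hedge : lastEdgeMap n ≫ σ₀ = SSet.yonedaEquiv.symm e := by
    rw [lastEdgeMap_comp, hσ₀]
  have htail (d : ℕ) (x : (Δ[n + 2 + 2] : SSet.{u}) _⦋d⦌) (hx : ∀ i, n < (x i : ℕ))
      (hb : ∀ i, x i ≠ b) : ∃ y : (Δ[2] : SSet.{u}) _⦋d⦌,
        (stdSimplex.δ (1 : Fin 4)).app _ y = (tail n 2).app _ x ∧
        (stdSimplex.σ (0 : Fin 2)).app _ y = (toEdge n 2).app _ x := by
    have hcases (i : Fin (d + 1)) : (x i : ℕ) = n + 1 ∨ (x i : ℕ) = n + 3 ∨ (x i : ℕ) = n + 4 := by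
      have h₁ := hx i
      have h₂ : (x i : ℕ) ≠ n + 2 := fun h ↦ hb i (Fin.ext h)
      have h₃ := (x i).2
      omega
    refine ⟨(natMap (a := n + 2 + 2) (fun i ↦ i - (n + 2)) (fun _ _ h ↦ by simp only; omega)
      (fun _ h ↦ by omega)).app _ x, ?_, ?_⟩
    · apply SSet.stdSimplex.ext
      intro i
      apply Fin.ext
      change ((1 : Fin 4).succAbove ⟨(x i : ℕ) - (n + 2), _⟩ : Fin 4).val = (x i : ℕ) - (n + 1)
      rcases hcases i with h | h | h <;> simp [h, Fin.succAbove]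
    · apply SSet.stdSimplex.ext
      intro i
      apply Fin.ext
      change ((0 : Fin 2).predAbove ⟨(x i : ℕ) - (n + 2), _⟩ : Fin 2).val = (x i : ℕ) - (n + 1 + 2)
      rcases hcases i with h | h | h <;> simp [h, Fin.predAbove]
  have htail' (d : ℕ) (x : (Δ[n + 2 + 2] : SSet.{u}) _⦋d⦌) (hx : ∀ i, n < (x i : ℕ)) :
      (stdSimplex.σ (0 : Fin 2)).app _ ((stdSimplex.σ (0 : Fin 3)).app _ ((tail n 2).app _ x)) =
        (toEdge n 2).app _ x := by
    apply SSet.stdSimplex.ext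
    intro i
    apply Fin.ext
    change ((0 : Fin 2).predAbove ((0 : Fin 3).predAbove ⟨(x i : ℕ) - (n + 1), _⟩) : Fin 2).val =
      (x i : ℕ) - (n + 1 + 2)
    have h₁ := hx i
    have h₂ := (x i).2
    have h₃ : (x i : ℕ) = n + 1 ∨ (x i : ℕ) = n + 2 ∨ (x i : ℕ) = n + 3 ∨ (x i : ℕ) = n + 4 := by
      omega
    rcases h₃ with h | h | h | h <;> simp [h, Fin.predAbove]
  -- Off `b`, these are the simplices that `collapse` sends into the horn: `a` and `a'` have the
  -- same image, so both must be absent for it to be missed.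
  let P : LowerSet (Finset (Fin (n + 2 + 2 + 1))) :=
    avoiding b ⊓ (missing A ⊔ avoiding a ⊓ avoiding a')
  have hP : Subcomplex.range ((faces.{u} P).ι ≫ collapse n 2) ≤ Λ[n + 2, Fin.last (n + 2)] := by
    refine collapse_mem_horn (k := 2) (fun t ht ↦ ?_)
    obtain ⟨hbt, ht | ⟨hat, ha't⟩⟩ := ht
    · obtain ⟨y, hy, hyt⟩ := Finset.not_subset.1 ht
      have hya : (y : ℕ) ≤ n := (hA y).1 hy
      refine ⟨⟨y, by omega⟩, fun i hi h ↦ ?_⟩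
      have h₂ : (i : ℕ) ≠ y := fun h ↦ hyt (Fin.ext h ▸ hi)
      have h₃ := i.2
      simp only at h
      omega
    · refine ⟨⟨n + 1, by omega⟩, fun i hi h ↦ ?_⟩
      have h₀ : (i : ℕ) ≠ n + 1 := fun h ↦ hat (Fin.ext (a := i) (b := a) h ▸ hi)
      have h₁ : (i : ℕ) ≠ n + 2 := fun h ↦ hbt (Fin.ext (a := i) (b := b) h ▸ hi)
      have h₂ : (i : ℕ) ≠ n + 3 := fun h ↦ ha't (Fin.ext (a := i) (b := a') h ▸ hi)
      have h₃ := i.2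
      simp only at h
      omega
  obtain ⟨f, hf₁, hf₂⟩ := exists_desc_sup (faces P) (faces (above n))
    (Subcomplex.lift _ hP ≫ σ₀) ((faces (above n)).ι ≫ tail n 2 ≫ w) (by
        rintro ⟨d⟩ x hK hL
        induction d using SimplexCategory.rec with | _ d
        rw [mem_faces_above] at hL
        obtain ⟨y, hy₁, hy₂⟩ := htail d x hL ((mem_faces_avoiding x).1 hK.1)
        refine (app_collapse_eq (n := n) (k := 2) σ₀ x hL _).trans ?_
        refine (app_congr hedge _).trans ?_
        refine Eq.trans ?_ (congr_arg (w.app _) hy₁)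
        exact (congr_arg ((SSet.yonedaEquiv.symm e).app _) hy₂.symm).trans (app_congr hw y).symm)
  have hf : f ≫ p = (faces (P ⊔ above n)).ι ≫ collapse n 2 ≫ τ := by
    refine hom_ext_sup ?_ ?_
    · rw [← Category.assoc, hf₁, Category.assoc, hτ]
      rfl
    · rw [← Category.assoc, hf₂]
      ext ⟨d⟩ ⟨x, hL⟩
      induction d using SimplexCategory.rec with | _ d
      rw [mem_faces_above] at hL
      refine Eq.trans ?_ (collapse_comp_app_eq (n := n) (k := 2) τ x hL).symm
      rw [← hτ]
      refine Eq.trans (app_congr hwp ((tail n 2).app _ x)) ?_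
      refine Eq.trans (congr_arg ((SSet.yonedaEquiv.symm e ≫ p).app _) (htail' d x hL)) ?_
      rw [← hedge]
      rfl
  let M : Set ((Δ[n + 2 + 2] : SSet.{u}) _⦋1⦌) := {stdSimplex.edge _ b c hbc.le}
  have hM : ∀ x ∈ M, ∃ hx : x ∈ (faces (P ⊔ above n)).obj (op ⦋1⦌),
      IsCartesianEdge p (f.app _ ⟨x, hx⟩) := by
    rintro x rfl
    have hx : stdSimplex.edge _ b c hbc.le ∈ (faces.{u} (above n)).obj (op ⦋1⦌) := by
      refine (mem_faces_above _).2 (fun i ↦ ?_)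
      fin_cases i <;> [exact ha.trans hab; exact ha.trans (hab.trans hbc)]
    refine ⟨Or.inr hx, ?_⟩
    have h₁ := app_congr hf₂ ⟨_, hx⟩
    have h₂ : (tail n 2).app _ (stdSimplex.edge _ b c hbc.le) =
        stdSimplex.objEquiv.symm (SimplexCategory.δ 1 ≫ SimplexCategory.δ 0 : ⦋1⦌ ⟶ ⦋3⦌) := by
      apply SSet.stdSimplex.ext
      intro i
      apply Fin.ext
      fin_cases i
      · change n + 2 - (n + 1) = 1
        omega
      · change n + 4 - (n + 1) = 3
        omega
    have h₃ : w.app _ (stdSimplex.objEquiv.symm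
        (SimplexCategory.δ 1 ≫ SimplexCategory.δ 0 : ⦋1⦌ ⟶ ⦋3⦌)) = X.δ 1 (X.δ 0 ω) := by
      change X.map (SimplexCategory.δ 1 ≫ SimplexCategory.δ 0 : ⦋1⦌ ⟶ ⦋3⦌).op ω = _
      rw [op_comp, X.map_comp]
      rfl
    have h₄ := h₁.trans ((congr_arg (w.app _) h₂).trans h₃)
    rw [← h₄] at he'
    exact he'
  -- The three added terms are the stages: outer horns at `c` ending in `b → c`, inner horns at `a`
  -- before `b`, inner horns at `b` before `a'`. The rest of the simplex is not needed, since the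
  -- solution avoids `a` and `b`.
  let R : LowerSet (Finset (Fin (n + 2 + 2 + 1))) :=
    P ⊔ above n ⊔ avoiding a' ⊓ (avoiding a ⊔ missing A) ⊔ missing A ⊔ avoiding a
  have hext : LiftsExtend p M (faces (P ⊔ above n)) (faces R) := by
    refine ((liftsExtend_faces c ?_ le_sup_left ?_ ?_ ?_).trans
      (liftsExtend_faces a ?_ le_sup_left ?_ ?_ ?_)).trans
      (liftsExtend_faces b ?_ le_sup_left ?_ ?_ ?_)
    · exact Or.inr (by simp)
    · rintro s (hs | ⟨hs, hs'⟩) h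
      · exact (h hs).elim
      · exact Or.inr ⟨insert_mem_avoiding ha'c.ne hs, hs'.imp
          (insert_mem_avoiding (hab.trans hbc).ne) (insert_mem_missing hcA)⟩
    · rintro s - (⟨h₁, h₂⟩ | h)
      · exact Or.inl ⟨(erase_mem_avoiding_iff hbc.ne).1 h₁, h₂.imp (erase_mem_missing_iff hcA).1
          (And.imp (erase_mem_avoiding_iff (hab.trans hbc).ne).1
            (erase_mem_avoiding_iff ha'c.ne).1)⟩
      · exact Or.inr ((erase_mem_above_iff (ha.trans (hab.trans hbc))).1 h)
    · rintro s (hs | ⟨hs, hs'⟩) h hcs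
      · exact (h hs).elim
      · rw [LowerSet.mem_sup_iff, not_or, not_mem_above_iff] at h
        obtain ⟨h, x, hxs, hx⟩ := h
        have hbs : b ∈ s := by
          by_contra hbs
          exact h ⟨hbs, hs'.symm.imp_right (fun h ↦ ⟨h, hs⟩)⟩
        refine fillableHorn_of_cartesian hxs hbs hcs ((hlow x hx).trans hab) hbc (fun y hy ↦ ?_) rfl
        have h₁ := y.2
        have h₂ : (y : ℕ) ≠ n + 3 := fun h ↦ hs (Fin.ext (a := y) (b := a') h ▸ hy)
        simp only [b, c, Fin.le_def, Fin.ext_iff]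
        omega
    · exact Or.inl (Or.inr (by simp))
    · rintro s (hs | hs) h
      · exact (h hs).elim
      · exact Or.inr (insert_mem_missing haA hs)
    · rintro s (hs | hs) h
      · exact hs
      · rcases h with (h | h) | h
        · exact Or.inl (Or.inl ⟨(erase_mem_avoiding_iff hab.ne').1 h.1, Or.inl hs⟩)
        · exact Or.inl (Or.inr ((erase_mem_above_iff ha).1 h))
        · exact Or.inr ⟨(erase_mem_avoiding_iff (hab.trans hba').ne').1 h.1, Or.inr hs⟩
    · rintro s (hs | hs) h has
      · exact (h hs).elim
      · rw [LowerSet.mem_sup_iff, LowerSet.mem_sup_iff, not_or, not_or, not_mem_above_iff] at h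
        obtain ⟨⟨h, x, hxs, hx⟩, -⟩ := h
        have hbs : b ∈ s := by
          by_contra hbs
          exact h ⟨hbs, Or.inl hs⟩
        exact fillableHorn_of_inner hxs has hbs (hlow x hx) hab
    · exact Or.inl (Or.inl (Or.inr (by simp)))
    · rintro s (hs | hs) h
      · exact (h hs).elim
      · exact Or.inr (insert_mem_avoiding hab.ne hs)
    · rintro s (hs | hs) h
      · exact hs
      · rcases h with ((h | h) | h) | h
        · rcases h.2 with h | h
          · exact Or.inr ((erase_mem_missing_iff hbA).1 h)
          · exact Or.inl (Or.inr ⟨(erase_mem_avoiding_iff hba'.ne').1 h.2, Or.inl hs⟩)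
        · exact Or.inl (Or.inl (Or.inr ((erase_mem_above_iff (ha.trans hab)).1 h)))
        · exact Or.inl (Or.inr ⟨(erase_mem_avoiding_iff hba'.ne').1 h.1, Or.inl hs⟩)
        · exact Or.inr ((erase_mem_missing_iff hbA).1 h)
    · rintro s (hs | hs) h hbs
      · exact (h hs).elim
      · rw [LowerSet.mem_sup_iff, LowerSet.mem_sup_iff, not_or, not_or, mem_missing, not_not] at h
        have ha's : a' ∈ s := by
          by_contra ha's
          exact h.1.2 ⟨ha's, Or.inl hs⟩
        have h0s : 0 ∈ s := h.2 ((hA 0).2 (Nat.zero_le _))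
        exact fillableHorn_of_inner h0s hbs ha's ((hlow 0 (Nat.zero_le _)).trans hab) hba'
  obtain ⟨_, hext⟩ := hext
  obtain ⟨f', hf', hf'p⟩ := hext f _ hf hM
  have hskip (d : ℕ) (x : (Δ[n + 2] : SSet.{u}) _⦋d⦌) (j : Fin (n + 2 + 2 + 1))
      (hj : (j : ℕ) = n + 1 ∨ (j : ℕ) = n + 2) : (skip n 2 n).app _ x ∈ (faces (avoiding j)).obj _ := by
    refine (mem_faces_avoiding _).2 (fun i hi ↦ ?_)
    have : (if (x i : ℕ) ≤ n then (x i : ℕ) else x i + 2) = j := congr_arg Fin.val hi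
    split_ifs at this <;> omega
  have hskipR : Subcomplex.range (skip.{u} n 2 n) ≤ faces R := by
    rintro ⟨d⟩ _ ⟨x, rfl⟩
    induction d using SimplexCategory.rec with | _ d
    exact Or.inr (hskip d x a (Or.inl rfl))
  have hskipP : Subcomplex.range (Λ[n + 2, Fin.last (n + 2)].ι ≫ skip.{u} n 2 n) ≤ faces P := by
    rintro ⟨d⟩ _ ⟨⟨x, hxΛ⟩, rfl⟩
    induction d using SimplexCategory.rec with | _ d
    obtain ⟨j, hj, hjx⟩ := (mem_horn_iff_notMem_range _ _).1 hxΛ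
    have hj' := Fin.lt_def.1 (Fin.lt_last_iff_ne_last.2 hj)
    rw [Fin.val_last] at hj'
    refine ⟨hskip d x b (Or.inr rfl), ?_⟩
    by_cases hjn : (j : ℕ) ≤ n
    · refine Or.inl ((mem_faces_missing _).2 ⟨⟨j, by omega⟩, (hA _).2 hjn, fun i hi ↦ ?_⟩)
      have : (if (x i : ℕ) ≤ n then (x i : ℕ) else x i + 2) = j := congr_arg Fin.val hi
      refine hjx ⟨i, Fin.ext ?_⟩
      split_ifs at this <;> omega
    · refine Or.inr ⟨hskip d x a (Or.inl rfl), (mem_faces_avoiding _).2 (fun i hi ↦ ?_)⟩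
      have : (if (x i : ℕ) ≤ n then (x i : ℕ) else x i + 2) = n + 3 := congr_arg Fin.val hi
      refine hjx ⟨i, Fin.ext ?_⟩
      split_ifs at this <;> omega
  refine ⟨Subcomplex.lift _ hskipR ≫ f', skip_comp_eq_of_collapse le_rfl n.le_succ hP
    (le_sup_left.trans (le_sup_left.trans le_sup_left)) hf₁ hf' hskipP _, ?_⟩
  rw [Category.assoc, hf'p]
  exact congr_arg (· ≫ τ) (skip_comp_collapse.{u} (n := n) (k := 2) le_rfl n.le_succ)

end Retract

/-! ### Low-dimensional fillers, and comparison of two cartesian lifts. -/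

section Simplices

variable {X S : SSet.{u}} {p : X ⟶ S}

/-- A lifting property of `p` for the horn `Λ[n + 2, i]`, expressed in terms of simplices. -/
lemma exists_simplex_of_exists_lift {n : ℕ} {i : Fin (n + 3)} (x : ∀ j : Fin (n + 3), j ≠ i → X _⦋n + 1⦌)
    (s : S _⦋n + 2⦌)
    (hx : ∀ (j k : Fin (n + 3)) (hj : j ≠ i) (hk : k ≠ i) (hjk : j < k),
      X.δ (k.pred (Fin.ne_zero_of_lt hjk)) (x j hj) =
        X.δ (j.castPred (Fin.ne_last_of_lt hjk)) (x k hk))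
    (hs : ∀ j hj, S.δ j s = p.app _ (x j hj))
    (hlift : ∀ (σ₀ : (Λ[n + 2, i] : SSet.{u}) ⟶ X) (τ : Δ[n + 2] ⟶ S),
      σ₀ ≫ p = Λ[n + 2, i].ι ≫ τ → (∀ j hj, σ₀.app _ (horn.face i j hj) = x j hj) →
      ∃ σ : Δ[n + 2] ⟶ X, Λ[n + 2, i].ι ≫ σ = σ₀ ∧ σ ≫ p = τ) :
    ∃ y : X _⦋n + 2⦌, (∀ j hj, X.δ j y = x j hj) ∧ p.app _ y = s := by
  have hc : horn.IsCompatible (i := i) (fun j hj ↦ SSet.yonedaEquiv.symm (x j hj)) := by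
    rw [horn.isCompatible_iff]
    intro j k hj hk hjk
    rw [stdSimplex.δ_comp_yonedaEquiv_symm, stdSimplex.δ_comp_yonedaEquiv_symm, hx j k hj hk hjk]
  have hface (j) (hj : j ≠ i) : hc.desc.app _ (horn.face i j hj) = x j hj := by
    have := congr_arg SSet.yonedaEquiv (hc.ι_desc j hj)
    rw [Equiv.apply_symm_apply] at this
    rw [← this, ← horn.yonedaEquiv_ι]
    rfl
  obtain ⟨σ, hσ, hσp⟩ := hlift hc.desc (SSet.yonedaEquiv.symm s) (by
    refine horn.hom_ext' (fun j hj ↦ ?_)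
    rw [hc.ι_desc_assoc, horn.ι_ι_assoc, stdSimplex.δ_comp_yonedaEquiv_symm, hs j hj,
      SSet.yonedaEquiv_symm_comp]) hface
  refine ⟨SSet.yonedaEquiv σ, fun j hj ↦ ?_, ?_⟩
  · rw [← hface j hj, ← hσ, ← stdSimplex.yonedaEquiv_δ_comp, ← horn.yonedaEquiv_ι]
    rfl
  · rw [← SSet.yonedaEquiv_comp, hσp, Equiv.apply_symm_apply]

lemma exists_simplex_of_inner [hp : InnerFibration p] {n : ℕ} {i : Fin (n + 3)} (h₀ : 0 < i)
    (h₁ : i < Fin.last (n + 2)) (x : ∀ j : Fin (n + 3), j ≠ i → X _⦋n + 1⦌) (s : S _⦋n + 2⦌)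
    (hx : ∀ (j k : Fin (n + 3)) (hj : j ≠ i) (hk : k ≠ i) (hjk : j < k),
      X.δ (k.pred (Fin.ne_zero_of_lt hjk)) (x j hj) =
        X.δ (j.castPred (Fin.ne_last_of_lt hjk)) (x k hk))
    (hs : ∀ j hj, S.δ j s = p.app _ (x j hj)) :
    ∃ y : X _⦋n + 2⦌, (∀ j hj, X.δ j y = x j hj) ∧ p.app _ y = s := by
  refine exists_simplex_of_exists_lift x s hx hs (fun σ₀ τ h _ ↦ ?_)
  have := hp.mem _ (horn_ι_mem_innerHornInclusions h₀ h₁)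
  have sq : CommSq σ₀ Λ[n + 2, i].ι p τ := ⟨h⟩
  exact ⟨sq.lift, sq.fac_left, sq.fac_right⟩

lemma exists_triangle_of_inner [InnerFibration p] {e f : X _⦋1⦌} (h : X.δ 1 e = X.δ 0 f)
    {s : S _⦋2⦌} (h₀ : S.δ 0 s = p.app _ e) (h₂ : S.δ 2 s = p.app _ f) :
    ∃ y : X _⦋2⦌, X.δ 0 y = e ∧ X.δ 2 y = f ∧ p.app _ y = s := by
  obtain ⟨y, hy, hyp⟩ := exists_simplex_of_inner (p := p) (i := 1) (by decide) (by decide)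
    (fun j _ ↦ ![e, e, f] j) s (by
      intro j k hj hk hjk
      fin_cases j <;> fin_cases k <;>
        first
        | (exact absurd hjk (by decide))
        | (exact absurd rfl hj)
        | (exact absurd rfl hk)
        | skip
      exact h) (by
      intro j hj
      fin_cases j
      exacts [h₀, absurd rfl hj, h₂])
  exact ⟨y, hy 0 (by decide), hy 2 (by decide), hyp⟩

lemma exists_tetrahedron_of_inner [InnerFibration p] {x₀ x₁ x₃ : X _⦋2⦌}
    (h₀₁ : X.δ 0 x₀ = X.δ 0 x₁) (h₀₃ : X.δ 2 x₀ = X.δ 0 x₃) (h₁₃ : X.δ 2 x₁ = X.δ 1 x₃)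
    {s : S _⦋3⦌} (h₀ : S.δ 0 s = p.app _ x₀) (h₁ : S.δ 1 s = p.app _ x₁)
    (h₃ : S.δ 3 s = p.app _ x₃) :
    ∃ y : X _⦋3⦌, X.δ 0 y = x₀ ∧ X.δ 1 y = x₁ ∧ X.δ 3 y = x₃ ∧ p.app _ y = s := by
  obtain ⟨y, hy, hyp⟩ := exists_simplex_of_inner (p := p) (i := 2) (by decide) (by decide)
    (fun j _ ↦ ![x₀, x₁, x₁, x₃] j) s (by
      intro j k hj hk hjk
      fin_cases j <;> fin_cases k <;>
        first
        | (exact absurd hjk (by decide))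
        | (exact absurd rfl hj)
        | (exact absurd rfl hk)
        | skip
      exacts [h₀₁, h₀₃, h₁₃]) (by
      intro j hj
      fin_cases j
      exacts [h₀, h₁, absurd rfl hj, h₃])
  exact ⟨y, hy 0 (by decide), hy 1 (by decide), hy 3 (by decide), hyp⟩

lemma lastEdge_zero : lastEdge.{u} 0 = horn.face (Fin.last 2) 0 (by decide) := by
  apply Subtype.ext
  ext i : 1
  fin_cases i <;> rfl

lemma IsCartesianEdge.exists_triangle {e f : X _⦋1⦌} (he : IsCartesianEdge p e)
    (h : X.δ 0 e = X.δ 0 f) {s : S _⦋2⦌} (h₀ : S.δ 0 s = p.app _ e) (h₁ : S.δ 1 s = p.app _ f) :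
    ∃ y : X _⦋2⦌, X.δ 0 y = e ∧ X.δ 1 y = f ∧ p.app _ y = s := by
  obtain ⟨y, hy, hyp⟩ := exists_simplex_of_exists_lift (p := p) (i := Fin.last 2)
    (fun j _ ↦ ![e, f, f] j) s (by
      intro j k hj hk hjk
      fin_cases j <;> fin_cases k <;>
        first
        | (exact absurd hjk (by decide))
        | (exact absurd rfl hj)
        | (exact absurd rfl hk)
        | skip
      exact h) (by
      intro j hj
      fin_cases j
      exacts [h₀, h₁, absurd rfl hj]) (fun σ₀ τ hτ hface ↦ he 0 σ₀ τ hτ (by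
        rw [lastEdge_zero, hface]
        rfl))
  exact ⟨y, hy 0 (by decide), hy 1 (by decide), hyp⟩

lemma IsCartesianEdge.exists_tetrahedron {x₀ x₁ x₂ : X _⦋2⦌} (he : IsCartesianEdge p (X.δ 0 x₀))
    (h₀₁ : X.δ 0 x₀ = X.δ 0 x₁) (h₀₂ : X.δ 1 x₀ = X.δ 0 x₂) (h₁₂ : X.δ 1 x₁ = X.δ 1 x₂)
    {s : S _⦋3⦌} (h₀ : S.δ 0 s = p.app _ x₀) (h₁ : S.δ 1 s = p.app _ x₁)
    (h₂ : S.δ 2 s = p.app _ x₂) :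
    ∃ y : X _⦋3⦌, X.δ 0 y = x₀ ∧ X.δ 1 y = x₁ ∧ X.δ 2 y = x₂ ∧ p.app _ y = s := by
  obtain ⟨y, hy, hyp⟩ := exists_simplex_of_exists_lift (p := p) (i := Fin.last 3)
    (fun j _ ↦ ![x₀, x₁, x₂, x₂] j) s (by
      intro j k hj hk hjk
      fin_cases j <;> fin_cases k <;>
        first
        | (exact absurd hjk (by decide))
        | (exact absurd rfl hj)
        | (exact absurd rfl hk)
        | skip
      exacts [h₀₁, h₀₂, h₁₂]) (by
      intro j hj
      fin_cases j
      exacts [h₀, h₁, h₂, absurd rfl hj]) (fun σ₀ τ hτ hface ↦ he 1 σ₀ τ hτ (by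
        rw [show lastEdge.{u} 1 = (Λ[3, Fin.last 3] : SSet.{u}).δ 0
            (horn.face (Fin.last 3) 0 (by decide)) by
          apply Subtype.ext
          ext i : 1
          fin_cases i <;> rfl, δ_naturality_apply, hface]
        rfl))
  exact ⟨y, hy 0 (by decide), hy 1 (by decide), hy 2 (by decide), hyp⟩

/-- Each edge factors through the other. The two triangles and the degenerate triangle on `e` form
an outer horn with last edge `e`; the new face of its filler shows that the two factors compose to
an identity. -/
lemma IsCartesianEdge.exists_retract {e e' : X _⦋1⦌} (he : IsCartesianEdge p e)
    (he' : IsCartesianEdge p e') (h : X.δ 0 e = X.δ 0 e') (hp : p.app _ e = p.app _ e') :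
    ∃ ω : X _⦋3⦌, X.δ 1 ω = X.σ 0 e ∧ X.δ 1 (X.δ 0 ω) = e' ∧
      p.app _ ω = S.σ 0 (S.σ 0 (p.app _ e)) := by
  have hσ₀ (Y : SSet.{u}) (n : ℕ) (y : Y _⦋n + 1⦌) : Y.δ 0 (Y.σ 0 y) = y :=
    δ_comp_σ_self_apply 0 y
  have hσ₁ (Y : SSet.{u}) (n : ℕ) (y : Y _⦋n + 1⦌) : Y.δ 1 (Y.σ 0 y) = y :=
    δ_comp_σ_succ_apply 0 y
  obtain ⟨α, hα₀, hα₁, hαp⟩ := he'.exists_triangle h.symm (s := S.σ 0 (p.app _ e))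
    (by rw [hσ₀, hp]) (hσ₁ ..)
  obtain ⟨β, hβ₀, hβ₁, hβp⟩ := he.exists_triangle h (s := S.σ 0 (p.app _ e))
    (hσ₀ ..) (by rw [hσ₁, hp])
  obtain ⟨ω, h₀, h₁, -, hω⟩ := IsCartesianEdge.exists_tetrahedron (p := p) (x₀ := β)
    (x₁ := X.σ 0 e) (x₂ := α) (s := S.σ 0 (S.σ 0 (p.app _ e))) (by rwa [hβ₀])
    (by rw [hβ₀, hσ₀]) (by rw [hβ₁, hα₀]) (by rw [hσ₁, hα₁]) (by rw [hσ₀, hβp])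
    (by rw [hσ₁, σ_naturality_apply]) (by
      rw [hαp]
      refine (δ_comp_σ_of_gt_apply (i := 1) (j := 0) (by decide) (S.σ 0 (p.app _ e))).trans ?_
      exact congr_arg (S.σ 0) (hσ₁ ..))
  exact ⟨ω, h₁, by rw [h₀, hβ₁], hω⟩

end Simplices

/-! ### Membership of simplices in a subcategory. -/

section Subcategory

variable {E : SSet.{u}} {E₀ : E.Subcomplex}

/-- Lift the horn against the inclusion over `x` itself: the filler is a simplex of `E₀` equal to
`x`. -/
lemma IsSubcategory.mem (hE₀ : IsSubcategory E₀) {n : ℕ} {i : Fin (n + 3)} (h₀ : 0 < i)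
    (h₁ : i < Fin.last (n + 2)) {x : E _⦋n + 2⦌}
    (hx : ∀ j, j ≠ i → E.δ j x ∈ E₀.obj (op ⦋n + 1⦌)) : x ∈ E₀.obj (op ⦋n + 2⦌) := by
  have : InnerFibration E₀.ι := hE₀
  obtain ⟨y, -, hy⟩ := exists_simplex_of_inner (p := E₀.ι) h₀ h₁
    (fun j hj ↦ ⟨E.δ j x, hx j hj⟩) x (by
      intro j k hj hk hjk
      apply Subtype.ext
      change E.δ _ (E.δ j x) = E.δ _ (E.δ k x)
      have := δ_comp_δ_apply (S := E) (i := j.castPred (Fin.ne_last_of_lt hjk))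
        (j := k.pred (Fin.ne_zero_of_lt hjk)) (by
          rw [Fin.le_def]
          have := Fin.lt_def.1 hjk
          simp
          omega) x
      simpa using this.symm) (fun _ _ ↦ rfl)
  exact hy ▸ y.2

lemma IsSubcategory.mem_triangle (hE₀ : IsSubcategory E₀) {x : E _⦋2⦌}
    (h₀ : E.δ 0 x ∈ E₀.obj (op ⦋1⦌)) (h₂ : E.δ 2 x ∈ E₀.obj (op ⦋1⦌)) : x ∈ E₀.obj (op ⦋2⦌) :=
  hE₀.mem (i := 1) (by decide) (by decide) (by
    intro j hj
    fin_cases j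
    exacts [h₀, absurd rfl hj, h₂])

lemma δ_mem {n : ℕ} (i : Fin (n + 2)) {x : E _⦋n + 1⦌} (hx : x ∈ E₀.obj (op ⦋n + 1⦌)) :
    E.δ i x ∈ E₀.obj (op ⦋n⦌) :=
  E₀.map (SimplexCategory.δ i).op hx

/-- The faces of the last facet are also faces of other facets. As that facet has dimension at least
2, an inner horn puts it in `E₀`, and another then does so for `x`. -/
lemma IsSubcategory.mem_of_last (hE₀ : IsSubcategory E₀) {n : ℕ} {x : E _⦋n + 3⦌}
    (hx : ∀ j, j ≠ Fin.last (n + 3) → E.δ j x ∈ E₀.obj (op ⦋n + 2⦌)) :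
    x ∈ E₀.obj (op ⦋n + 3⦌) := by
  refine hE₀.mem (i := 1) Fin.zero_lt_one (by rw [Fin.lt_def]; simp) (fun j hj ↦ ?_)
  by_cases hjl : j = Fin.last (n + 3)
  · subst hjl
    refine hE₀.mem (i := 1) Fin.zero_lt_one (by rw [Fin.lt_def]; simp) (fun k hk ↦ ?_)
    have := δ_comp_δ_apply (S := E) (i := k) (j := Fin.last (n + 2)) (Fin.le_last _) x
    rw [Fin.succ_last] at this
    rw [this]
    exact δ_mem _ (hx _ (Fin.castSucc_lt_last k).ne)
  · exact hx j hjl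

end Subcategory

/-! ### Cancellation in `E₀` and restriction of cartesian edges. -/

section Main

variable {E B : SSet.{u}} {p : E ⟶ B} {E₀ : E.Subcomplex}

/-- The source-side cancellation property for `E₀`, over an arbitrary 2-simplex of `B`. -/
lemma mem_of_comp_mem [InnerFibration p] [Quasicategory B] (hE₀ : IsSubcategory E₀)
    (h_lift : ∀ (x : E _⦋0⦌) (f : B _⦋1⦌), x ∈ E₀.obj (op ⦋0⦌) → B.δ 0 f = p.app _ x →
      ∃ e : E _⦋1⦌, IsCartesianEdge p e ∧ E.δ 0 e = x ∧ p.app _ e = f ∧ e ∈ E₀.obj (op ⦋1⦌))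
    (h_factor : ∀ φ e ψ : E _⦋1⦌,
      E.δ 1 φ ∈ E₀.obj (op ⦋0⦌) → E.δ 0 φ ∈ E₀.obj (op ⦋0⦌) →
      IsCartesianEdge p e → e ∈ E₀.obj (op ⦋1⦌) → IsFactorThrough p φ e ψ →
      (φ ∈ E₀.obj (op ⦋1⦌) ↔ ψ ∈ E₀.obj (op ⦋1⦌)))
    {σ : E _⦋2⦌} (hσ : IsCartesianEdge p (E.δ 0 σ)) (h₀ : E.δ 0 σ ∈ E₀.obj (op ⦋1⦌))
    (h₁ : E.δ 1 σ ∈ E₀.obj (op ⦋1⦌)) : E.δ 2 σ ∈ E₀.obj (op ⦋1⦌) := by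
  have hσ₀ (Y : SSet.{u}) (n : ℕ) (y : Y _⦋n + 1⦌) : Y.δ 0 (Y.σ 0 y) = y :=
    δ_comp_σ_self_apply 0 y
  have hσ₁ (Y : SSet.{u}) (n : ℕ) (y : Y _⦋n + 1⦌) : Y.δ 1 (Y.σ 0 y) = y :=
    δ_comp_σ_succ_apply 0 y
  have h₀₂ : E.δ 1 (E.δ 0 σ) = E.δ 0 (E.δ 2 σ) :=
    (δ_comp_δ_apply (S := E) (i := 0) (j := 1) (by decide) σ).symm
  have h₁₂ : E.δ 1 (E.δ 1 σ) = E.δ 1 (E.δ 2 σ) :=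
    (δ_comp_δ_apply (S := E) (i := 1) (j := 1) (by decide) σ).symm
  have htgt : E.δ 0 (E.δ 2 σ) ∈ E₀.obj (op ⦋0⦌) := h₀₂ ▸ δ_mem 1 h₀
  have hsrc : E.δ 1 (E.δ 2 σ) ∈ E₀.obj (op ⦋0⦌) := h₁₂ ▸ δ_mem 1 h₁
  obtain ⟨e', he', he'₀, he'p, he'E⟩ := h_lift (E.δ 0 (E.δ 2 σ)) (p.app _ (E.δ 2 σ)) htgt
    (δ_naturality_apply ..).symm
  obtain ⟨ρ, hρ₀, hρ₂, hρp⟩ := exists_triangle_of_inner (p := p) (e := E.δ 0 σ) (f := e')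
    (s := p.app _ σ) (by rw [he'₀, h₀₂]) (δ_naturality_apply ..).symm
    (by rw [he'p, δ_naturality_apply])
  have hρE : ρ ∈ E₀.obj (op ⦋2⦌) := hE₀.mem_triangle (hρ₀ ▸ h₀) (hρ₂ ▸ he'E)
  have hc : IsCartesianEdge p (E.δ 1 ρ) := .comp (hρ₀ ▸ hσ) (hρ₂ ▸ he')
  obtain ⟨ν, hν₀, hν₁, hνp⟩ := he'.exists_triangle he'₀ (s := B.σ 0 (p.app _ (E.δ 2 σ)))
    (by rw [hσ₀, he'p]) (hσ₁ ..)
  -- The new face `δ 2 κ` exhibits `δ 1 σ` as the cartesian edge `δ 1 ρ` after `δ 2 ν`, the factor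
  -- of `δ 2 σ` through `e'`.
  obtain ⟨κ, hκ₀, hκ₁, hκ₃, hκp⟩ := exists_tetrahedron_of_inner (p := p) (x₀ := ρ) (x₁ := σ)
    (x₃ := ν) (s := B.σ 0 (p.app _ σ)) hρ₀ (by rw [hρ₂, hν₀]) hν₁.symm (by rw [hσ₀, hρp])
    (hσ₁ ..) (by
      rw [hνp, δ_naturality_apply]
      exact δ_comp_σ_of_gt_apply (i := 2) (j := 0) (by decide) (p.app _ σ))
  have hφ : IsFactorThrough p (E.δ 1 σ) (E.δ 1 ρ) (E.δ 2 ν) := by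
    refine ⟨E.δ 2 κ, ?_, ?_, ?_, ?_⟩
    · rw [← hκ₀]
      exact δ_comp_δ_apply (S := E) (i := 0) (j := 1) (by decide) κ
    · rw [← hκ₁]
      exact δ_comp_δ_apply (S := E) (i := 1) (j := 1) (by decide) κ
    · rw [← hκ₃]
      exact (δ_comp_δ_apply (S := E) (i := 2) (j := 2) (by decide) κ).symm
    · rw [δ_naturality_apply, hκp, δ_naturality_apply]
      exact δ_comp_σ_of_gt_apply (i := 1) (j := 0) (by decide) (p.app _ σ)
  have hψ := (h_factor _ _ _ (δ_mem 1 h₁) (δ_mem 0 h₁) hc (δ_mem 1 hρE) hφ).1 h₁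
  exact (h_factor _ _ _ hsrc htgt he' he'E ⟨ν, hν₀, hν₁, rfl, hνp⟩).2 hψ

/-- A filler in `E` has all facets but the last in `E₀`. In dimension 2 the last one is an edge and
needs `h_mem`; above that, `mem_of_last` suffices. -/
lemma isCartesianEdge_restrict (hE₀ : IsSubcategory E₀)
    (h_mem : ∀ σ : E _⦋2⦌, IsCartesianEdge p (E.δ 0 σ) → E.δ 0 σ ∈ E₀.obj (op ⦋1⦌) →
      E.δ 1 σ ∈ E₀.obj (op ⦋1⦌) → E.δ 2 σ ∈ E₀.obj (op ⦋1⦌))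
    {e : (E₀ : SSet.{u}) _⦋1⦌} (he : IsCartesianEdge p (E₀.ι.app _ e)) :
    IsCartesianEdge (E₀.ι ≫ p) e := by
  intro n σ₀ τ hτ hσ₀
  obtain ⟨σ, hσ, hσp⟩ := he n (σ₀ ≫ E₀.ι) τ (by rw [Category.assoc, hτ])
    (congr_arg (E₀.ι.app _) hσ₀)
  have hface (j) (hj : j ≠ Fin.last (n + 2)) :
      E.δ j (SSet.yonedaEquiv σ) = (σ₀.app _ (horn.face _ j hj)).1 := by
    have := app_congr hσ (horn.face _ j hj)
    refine Eq.trans ?_ this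
    rw [← stdSimplex.yonedaEquiv_δ_comp, ← horn.yonedaEquiv_ι]
    rfl
  have hmem : SSet.yonedaEquiv σ ∈ E₀.obj (op ⦋n + 2⦌) := by
    have hfaces (j) (hj : j ≠ Fin.last (n + 2)) :
        E.δ j (SSet.yonedaEquiv σ) ∈ E₀.obj (op ⦋n + 1⦌) := hface j hj ▸ (σ₀.app _ _).2
    obtain _ | n := n
    · refine hE₀.mem_triangle (hfaces 0 (by decide)) (h_mem _ ?_ (hfaces 0 (by decide))
        (hfaces 1 (by decide)))
      rw [hface 0 (by decide), ← lastEdge_zero, hσ₀]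
      exact he
    · exact hE₀.mem_of_last hfaces
  have hrange : Subcomplex.range σ ≤ E₀ := by
    rwa [Subcomplex.range_eq_ofSimplex, Subcomplex.ofSimplex_le_iff]
  refine ⟨Subcomplex.lift σ hrange, ?_, ?_⟩
  · rw [← cancel_mono E₀.ι, ← hσ]; rfl
  · rw [← hσp]; rfl

end Main

end CartFib

theorem mainTheorem12 {E B : SSet.{u}} [SSet.Quasicategory E] [SSet.Quasicategory B]
    (p : E ⟶ B) (hp : CartFib.IsCartesianFibration p)
    (E₀ : E.Subcomplex) (hE₀ : CartFib.IsSubcategory E₀)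
    (h_lift : ∀ (x : E _⦋0⦌) (f : B _⦋1⦌), x ∈ E₀.obj (op ⦋0⦌) → B.δ 0 f = p.app _ x →
      ∃ e : E _⦋1⦌, CartFib.IsCartesianEdge p e ∧ E.δ 0 e = x ∧ p.app _ e = f ∧
        e ∈ E₀.obj (op ⦋1⦌))
    (h_factor : ∀ φ e ψ : E _⦋1⦌,
      E.δ 1 φ ∈ E₀.obj (op ⦋0⦌) → E.δ 0 φ ∈ E₀.obj (op ⦋0⦌) →
      CartFib.IsCartesianEdge p e → e ∈ E₀.obj (op ⦋1⦌) →
      CartFib.IsFactorThrough p φ e ψ →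
      (φ ∈ E₀.obj (op ⦋1⦌) ↔ ψ ∈ E₀.obj (op ⦋1⦌))) :
    CartFib.IsCartesianFibration (E₀.ι ≫ p) ∧
      ∀ e : (E₀ : SSet.{u}) _⦋1⦌,
        CartFib.IsCartesianEdge (E₀.ι ≫ p) e ↔ CartFib.IsCartesianEdge p (E₀.ι.app _ e) := by
  have := hp.innerFibration
  have hι : SSet.InnerFibration E₀.ι := hE₀
  have hrestrict {e : (E₀ : SSet.{u}) _⦋1⦌} (he : CartFib.IsCartesianEdge p (E₀.ι.app _ e)) :
      CartFib.IsCartesianEdge (E₀.ι ≫ p) e :=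
    CartFib.isCartesianEdge_restrict hE₀
      (fun _ h h₀ h₁ ↦ CartFib.mem_of_comp_mem hE₀ h_lift h_factor h h₀ h₁) he
  have hlift₀ (y : (E₀ : SSet.{u}) _⦋0⦌) (f : B _⦋1⦌) (hf : B.δ 0 f = (E₀.ι ≫ p).app _ y) :
      ∃ e : (E₀ : SSet.{u}) _⦋1⦌, CartFib.IsCartesianEdge p (E₀.ι.app _ e) ∧
        (E₀ : SSet.{u}).δ 0 e = y ∧ (E₀.ι ≫ p).app _ e = f := by
    obtain ⟨e, he, he₀, hep, heE⟩ := h_lift y.1 f y.2 hf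
    exact ⟨⟨e, heE⟩, he, Subtype.ext he₀, hep⟩
  refine ⟨⟨⟨SSet.innerFibrations.comp_mem _ _ hι.mem this.mem⟩, fun y f hf ↦ ?_⟩,
    fun e ↦ ⟨fun he ↦ ?_, hrestrict⟩⟩
  · obtain ⟨e, he, h⟩ := hlift₀ y f hf
    exact ⟨e, hrestrict he, h⟩
  · obtain ⟨e', he', h₀, hp'⟩ := hlift₀ ((E₀ : SSet.{u}).δ 0 e) ((E₀.ι ≫ p).app _ e)
      (SSet.δ_naturality_apply ..).symm
    -- The comparison must take place in `E₀`, the only place where `e` is known to be cartesian;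
    -- `ω` is then mapped to `E`, where `e'` is cartesian.
    obtain ⟨ω, h₁, h₂, h₃⟩ := he.exists_retract (hrestrict he') h₀.symm hp'.symm
    refine CartFib.IsCartesianEdge.of_retract (ω := E₀.ι.app _ ω)
      (congr_arg (E₀.ι.app _) h₁) h₃ ?_
    have : E.δ 1 (E.δ 0 (E₀.ι.app _ ω)) = E₀.ι.app _ e' := congr_arg (E₀.ι.app _) h₂
    rwa [this]
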